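/- **Theorem 5.** For a finite set $A\subset\mathbb{R}$ write $A+A=\{a+b: a,b\in A\}$ and $A/A=\{a/b: a,b\in A,\ b\neq 0\}$. (i) There are absolute constants $C,c>0$ such that for every finite $A\subset\mathbb{R}$ with $|A|\ge 2$ and every real $K\ge 1$ with $|A/A|\le K|A|$, $$\max\left\{|A|^{19/12}K^{-5/6},\ |A|^{1313/830}K^{-336/415}\right\}\ \le\ C\,|A+A|\,(\log|A|)^{c}.$$ (ii) This bound improves, in the following sense, the earlier bounds, in which the left-hand side above is replaced by $|A|^{19/12}K^{-5/6}$ or by $|A|^{49/32}K^{-19/32}$. For all real $N\ge 2$ and $K$ with $N^{5/23}\le K<N^{673/2867}$, $$\max\left\{N^{19/12}K^{-5/6},\ N^{49/32}K^{-19/32}\right\}<\max\left\{N^{19/12}K^{-5/6},\ N^{1313/830}K^{-336/415}\right\}.$$ Moreover, for all $C_1,c_1>0$ there are $C,c>0$ such that for all real $N\ge 2$ and $K\ge 1$ with $N^{5/23}\le C_1K(\log N)^{c_1}$ and $K\le C_1N^{673/2867}(\log N)^{c_1}$, $$\max\left\{N^{19/12}K^{-5/6},\ N^{49/32}K^{-19/32}\right\}\le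 C\,N^{1313/830}K^{-336/415}\,(\log N)^{c}.$$ -/

import Mathlib

open scoped Pointwise

/-!
After taking logarithms, the comparisons of the bounds in ranges of `K` become linear inequalities
between `log N`, `log K` and `log log N`. For the sum-set bound a stronger estimate is proved,
`|A| ^ (19 / 12) K ^ (-4 / 5) ≪ |A + A| (log |A|) ^ 6`, which implies both bounds at once because
`4 / 5` is less than `5 / 6` and `336 / 415`, and `19 / 12` exceeds `1313 / 830`.

Let `A` consist of positive numbers, `N = |A|`, `Q = A / A` and `|Q| = K N`. The points of `A × A`
lie on the lines through the origin with slopes in `Q`. As in Solymosi's argument, sums of points of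
two such lines lie in the sector between them, and as in the work of Konyagin and Shkredov the
slopes are grouped into clusters of `M` consecutive ones: if a cluster of lines with `n` points each
has few coincidences among its `≈ M ^ 2 n ^ 2` sums, then `|A + A| ^ 2 ≫ M |Λ| n ^ 2`, where `Λ`
is the set of slopes (`mul_card_mul_sq_le`). This gains a factor `M` over Solymosi's bound.

Coincidences are solutions of `α a₁ + β a₂ = γ a₃` with `aᵢ` on three of the lines
(`card_raySum_eq_le`), and these are counted by incidences. If every `a₁` is a product `u v` with
`u ∈ U`, `v ∈ V` in `m` ways, a solution gives `m` incidences between the lines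
`x = (α u) v + β a₂` and the points `(v, γ a₃)` (`mul_card_solutions_le`). Only grids of points
occur, and for these the Szemerédi–Trotter bound follows by cutting the grid into boxes
(`card_incidences_le`).

There are two sources of such products on the line of slope `l`, and they complement each other.
Let `q` be the size of `Q ∩ l⁻¹ Q`. By the Katz–Koester inclusion one may take `U = Q ∩ l⁻¹ Q`,
`V = A`, `m = N`, which is efficient when `q` is small. If on the other hand `q` is large for the
typical slope, then the slopes themselves have many representations as quotients of elements of `Q`,
and `U`, `V` may be taken to be dilates of `Q` and `Q⁻¹` with `m = q`. Pigeonholing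
(`exists_dyadic_class`, `exists_linked_slopes`) makes both available for one set of slopes
(`exists_controlled_slopes`). The worst case `q = N K ^ (4 / 5)` produces the exponent `4 / 5`
(`pow_le_card_add_sq`).
-/

/-! ### Incidences between grids and lines -/

/-- A finite set of reals can be cut into consecutive blocks of at most `s` elements; `f` numbers
the blocks from left to right. -/
lemma exists_monotone_block_index (V : Finset ℝ) (s : ℕ) (hs : 0 < s) :
    ∃ f : ℝ → ℕ, Monotone f ∧ (∀ v, f v ≤ V.card / s) ∧
      ∀ v, (V.filter (fun w => f w = f v)).card ≤ s := by
  have hmono : Monotone (fun v : ℝ => (V.filter (· < v)).card) := by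
    intro v w hvw
    apply Finset.card_le_card
    intro z hz
    simp only [Finset.mem_filter] at hz ⊢
    exact ⟨hz.1, hz.2.trans_le hvw⟩
  refine ⟨fun v => (V.filter (· < v)).card / s, ?_, ?_, ?_⟩
  · intro v w hvw
    exact Nat.div_le_div_right (hmono hvw)
  · intro v
    exact Nat.div_le_div_right (Finset.card_filter_le _ _)
  · intro v
    set j := (V.filter (· < v)).card / s with hj
    have : (V.filter (fun w => (V.filter (· < w)).card / s = j)).card
        ≤ (Finset.Ico (j * s) (j * s + s)).card := by
      apply Finset.card_le_card_of_injOn (fun w => (V.filter (· < w)).card)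
      · intro w hw
        simp only [Finset.coe_filter, Set.mem_ofPred_eq] at hw
        simp only [Finset.coe_Ico, Set.mem_Ico]
        rw [← hw.2]
        have h1 := Nat.div_add_mod (V.filter (· < w)).card s
        have h2 := Nat.mod_lt (V.filter (· < w)).card hs
        rw [mul_comm s] at h1
        omega
      · have key : ∀ w ∈ V, ∀ z, w < z → (V.filter (· < w)).card < (V.filter (· < z)).card := by
          intro w hw z hwz
          apply Finset.card_lt_card
          refine Finset.ssubset_iff_of_subset ?_ |>.2 ⟨w, by simp [hw, hwz], by simp⟩
          intro y hy
          simp only [Finset.mem_filter] at hy ⊢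
          exact ⟨hy.1, hy.2.trans hwz⟩
        intro w hw z hz hwz
        simp only [Finset.coe_filter, Set.mem_ofPred_eq] at hw hz
        simp only at hwz
        rcases lt_trichotomy w z with h | h | h
        · exact absurd hwz (key w hw.1 z h).ne
        · exact h
        · exact absurd hwz (key z hz.1 w h).ne'
    simpa using this

/-- A set is at most the number of values of `φ` on it plus the number of ordered pairs of distinct
elements with the same value. -/
lemma card_le_card_image_add_card_offDiag {α β : Type*} [DecidableEq α] [DecidableEq β]
    (s : Finset α) (φ : α → β) :
    s.card ≤ (s.image φ).card + ((s.offDiag).filter (fun z => φ z.1 = φ z.2)).card := by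
  have h1 : s.card = ∑ c ∈ s.image φ, (s.filter (fun v => φ v = c)).card :=
    Finset.card_eq_sum_card_image φ s
  have h2 : ((s.offDiag).filter (fun z => φ z.1 = φ z.2)).card
      = ∑ c ∈ s.image φ, ((s.filter (fun v => φ v = c)).offDiag).card := by
    rw [Finset.card_eq_sum_card_fiberwise (f := fun z => φ z.1) (t := s.image φ)]
    · refine Finset.sum_congr rfl fun c _ => congrArg Finset.card ?_
      ext ⟨a, b⟩
      simp only [Finset.mem_filter, Finset.mem_offDiag]
      constructor
      · rintro ⟨⟨⟨ha, hb, hab⟩, h⟩, hc⟩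
        exact ⟨⟨ha, hc⟩, ⟨hb, h ▸ hc⟩, hab⟩
      · rintro ⟨⟨ha, hc⟩, ⟨hb, hc'⟩, hab⟩
        exact ⟨⟨⟨ha, hb, hab⟩, hc.trans hc'.symm⟩, hc⟩
    · intro z hz
      simp only [Finset.coe_filter, Finset.mem_offDiag, Set.mem_ofPred_eq] at hz
      exact Finset.mem_coe.2 (Finset.mem_image_of_mem φ hz.1.1)
  rw [h1, h2, Finset.card_eq_sum_ones (s.image φ), ← Finset.sum_add_distrib]
  refine Finset.sum_le_sum fun c _ => ?_
  rw [Finset.offDiag_card]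
  rcases Nat.lt_or_ge 1 (s.filter (fun v => φ v = c)).card with h | h
  · obtain ⟨k, hk⟩ := Nat.exists_eq_add_of_lt h
    rw [hk]
    have : (1 + k + 1) * (1 + k + 1) - (1 + k + 1) = (1 + k) * (1 + k + 1) := by
      rw [Nat.sub_eq_iff_eq_add (by nlinarith)]; ring
    rw [this]; nlinarith
  · omega

/-- Incidences between the grid `V × X` and the lines `x = u v + b` with `u ∈ U`, `b ∈ B`.
The second coordinate of the point is determined by `u`, `b` and `v`. -/
noncomputable def incidences (U B V X : Finset ℝ) : Finset ((ℝ × ℝ) × ℝ) :=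
  ((U ×ˢ B) ×ˢ V).filter (fun z => z.1.1 * z.2 + z.1.2 ∈ X)

lemma card_incidences (U B V X : Finset ℝ) :
    (incidences U B V X).card
      = ∑ l ∈ U ×ˢ B, (V.filter (fun v => l.1 * v + l.2 ∈ X)).card := by
  rw [incidences, Finset.card_filter, Finset.sum_product]
  refine Finset.sum_congr rfl fun l _ => ?_
  rw [Finset.card_filter]

/-- The grid is cut into boxes of `s₁ × s₂` points. A line of positive slope runs monotonically
through the boxes, so it meets few of them; inside a box any two points span one line. -/
lemma card_incidences_le_of_blocks (U B V X : Finset ℝ) (hU : ∀ u ∈ U, 0 < u) (s₁ s₂ : ℕ)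
    (h₁ : 0 < s₁) (h₂ : 0 < s₂) :
    (incidences U B V X).card ≤ (U.card * B.card) * (V.card / s₁ + X.card / s₂ + 1)
      + V.card * X.card * (s₁ * s₂) := by
  obtain ⟨f, hf, hfV, hfs⟩ := exists_monotone_block_index V s₁ h₁
  obtain ⟨g, hg, hgX, hgs⟩ := exists_monotone_block_index X s₂ h₂
  let W : ℝ × ℝ → Finset ℝ := fun l => V.filter (fun v => l.1 * v + l.2 ∈ X)
  let φ : ℝ × ℝ → ℝ → ℕ := fun l v => f v + g (l.1 * v + l.2)
  let O : ℝ × ℝ → Finset (ℝ × ℝ) := fun l => (W l).offDiag.filter (fun z => φ l z.1 = φ l z.2)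
  have himg : ∀ l, ((W l).image (φ l)).card ≤ V.card / s₁ + X.card / s₂ + 1 := by
    intro l
    rw [← Finset.card_range (V.card / s₁ + X.card / s₂ + 1)]
    apply Finset.card_le_card
    intro c hc
    obtain ⟨v, -, rfl⟩ := Finset.mem_image.1 hc
    have := hfV v
    have := hgX (l.1 * v + l.2)
    simp only [Finset.mem_range, φ]
    omega
  -- on a line of positive slope both block indices increase, so equal sums force equal boxes
  have hbox : ∀ l : ℝ × ℝ, 0 < l.1 → ∀ v w, φ l v = φ l w →
      f v = f w ∧ g (l.1 * v + l.2) = g (l.1 * w + l.2) := by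
    intro l hl v w h
    have aux : ∀ v w, v ≤ w → f v ≤ f w ∧ g (l.1 * v + l.2) ≤ g (l.1 * w + l.2) := by
      intro v w hvw
      refine ⟨hf hvw, hg ?_⟩
      have := mul_le_mul_of_nonneg_left hvw hl.le
      linarith
    simp only [φ] at h
    rcases le_total v w with hvw | hvw
    · have := aux v w hvw; omega
    · have := aux w v hvw; omega
  let R : Finset ((ℝ × ℝ) × (ℝ × ℝ)) :=
    ((V ×ˢ X) ×ˢ (V ×ˢ X)).filter (fun z => f z.2.1 = f z.1.1 ∧ g z.2.2 = g z.1.2)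
  have hR : R.card ≤ V.card * X.card * (s₁ * s₂) := by
    rw [Finset.card_filter, Finset.sum_product, ← Finset.card_product, ← smul_eq_mul]
    refine Finset.sum_le_card_nsmul _ _ _ fun z _ => ?_
    rw [← Finset.card_filter]
    calc _ ≤ ((V.filter (fun w => f w = f z.1)) ×ˢ (X.filter (fun w => g w = g z.2))).card := by
          apply Finset.card_le_card
          intro y hy
          simp only [Finset.mem_filter, Finset.mem_product] at hy ⊢
          tauto
      _ ≤ s₁ * s₂ := by
          rw [Finset.card_product]
          exact Nat.mul_le_mul (hfs _) (hgs _)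
  have hO : ∑ l ∈ U ×ˢ B, (O l).card ≤ R.card := by
    rw [← Finset.card_sigma]
    refine Finset.card_le_card_of_injOn
      (fun y => ((y.2.1, y.1.1 * y.2.1 + y.1.2), (y.2.2, y.1.1 * y.2.2 + y.1.2))) ?_ ?_
    · rintro ⟨⟨u, b⟩, v, w⟩ hy
      simp only [Finset.coe_sigma, Set.mem_sigma_iff, Finset.mem_coe, Finset.mem_product, O, W,
        Finset.mem_filter, Finset.mem_offDiag] at hy
      obtain ⟨⟨hu, hb⟩, ⟨⟨hv, hvX⟩, ⟨hw, hwX⟩, hne⟩, heq⟩ := hy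
      have := hbox (u, b) (hU u hu) v w heq
      simp only [R, Finset.coe_filter, Set.mem_ofPred_eq, Finset.mem_product]
      exact ⟨⟨⟨hv, hvX⟩, ⟨hw, hwX⟩⟩, this.1.symm, this.2.symm⟩
    · rintro ⟨⟨u, b⟩, v, w⟩ hy ⟨⟨u', b'⟩, v', w'⟩ hy' h
      simp only [Finset.coe_sigma, Set.mem_sigma_iff, Finset.mem_coe, O, W,
        Finset.mem_filter, Finset.mem_offDiag] at hy
      simp only [Prod.mk.injEq] at h
      obtain ⟨⟨h1, h2⟩, h3, h4⟩ := h
      subst h1 h3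
      have hne : v - w ≠ 0 := sub_ne_zero.2 hy.2.1.2.2
      have hu : u = u' := by
        have : (u - u') * (v - w) = 0 := by linarith
        rcases mul_eq_zero.1 this with h | h
        · linarith
        · exact absurd h hne
      subst hu
      have hb : b = b' := by linarith
      subst hb
      rfl
  rw [card_incidences]
  calc ∑ l ∈ U ×ˢ B, (W l).card
      ≤ ∑ l ∈ U ×ˢ B, ((V.card / s₁ + X.card / s₂ + 1) + (O l).card) :=
        Finset.sum_le_sum fun l _ => (card_le_card_image_add_card_offDiag (W l) (φ l)).trans
          (Nat.add_le_add_right (himg l) _)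
    _ ≤ _ := by
        rw [Finset.sum_add_distrib, Finset.sum_const, smul_eq_mul, Finset.card_product]
        exact Nat.add_le_add_left (hO.trans hR) _

/-- The Szemerédi–Trotter bound for a grid and a family of lines with slopes in `U` and intercepts
in `B`. With `P = |V| |X|` points and `L = |U| |B|` lines, the choice `ρ ^ 3 = P ^ 2 / L` yields the
usual `(P L) ^ (2 / 3)`; leaving `ρ` free avoids fractional powers. -/
lemma card_incidences_le (U B V X : Finset ℝ) (hU : ∀ u ∈ U, 0 < u) (ρ : ℝ) (hρ : 1 ≤ ρ) :
    ((incidences U B V X).card : ℝ)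
      ≤ 3 * (U.card * B.card) * ρ + 4 * (V.card * X.card) ^ 2 / ρ ^ 2 := by
  have hρ0 : 0 < ρ := by linarith
  have hpos : (0 : ℝ) ≤ 4 * (V.card * X.card) ^ 2 / ρ ^ 2 := by positivity
  have hUB : (0 : ℝ) ≤ U.card * B.card := by positivity
  -- a line has at most `min |V| |X|` points of the grid
  have triv : ∀ k : ℕ, (∀ l ∈ U ×ˢ B, (V.filter (fun v => l.1 * v + l.2 ∈ X)).card ≤ k) →
      (k : ℝ) ≤ ρ → ((incidences U B V X).card : ℝ)
      ≤ 3 * (U.card * B.card) * ρ + 4 * (V.card * X.card) ^ 2 / ρ ^ 2 := by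
    intro k hk hkρ
    have h1 : (incidences U B V X).card ≤ (U.card * B.card) * k := by
      rw [card_incidences, ← Finset.card_product, ← smul_eq_mul]
      exact Finset.sum_le_card_nsmul _ _ _ hk
    have h2 : ((incidences U B V X).card : ℝ) ≤ (U.card * B.card) * k := by exact_mod_cast h1
    nlinarith [mul_le_mul_of_nonneg_left hkρ hUB]
  by_cases hV : (V.card : ℝ) ≤ ρ
  · exact triv V.card (fun l _ => Finset.card_filter_le _ _) hV
  by_cases hX : (X.card : ℝ) ≤ ρ
  · refine triv X.card (fun l hl => ?_) hX
    have hl0 := hU l.1 (Finset.mem_product.1 hl).1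
    refine Finset.card_le_card_of_injOn (fun v => l.1 * v + l.2) (fun v hv => ?_) ?_
    · exact (Finset.mem_filter.1 hv).2
    · intro v _ w _ h
      simpa [hl0.ne'] using h
  push Not at hV hX
  have block : ∀ c : ℕ, ρ < c → 0 < ⌈(c : ℝ) / ρ⌉₊ ∧ (⌈(c : ℝ) / ρ⌉₊ : ℝ) ≤ 2 * (c / ρ) ∧
      ((c / ⌈(c : ℝ) / ρ⌉₊ : ℕ) : ℝ) ≤ ρ := by
    intro c hc
    have h1 : 1 < (c : ℝ) / ρ := by rwa [one_lt_div hρ0]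
    have h2 : (c : ℝ) / ρ ≤ ⌈(c : ℝ) / ρ⌉₊ := Nat.le_ceil _
    have h3 : (⌈(c : ℝ) / ρ⌉₊ : ℝ) < c / ρ + 1 := Nat.ceil_lt_add_one (by linarith)
    refine ⟨Nat.ceil_pos.2 (by linarith), by linarith, Nat.cast_div_le.trans ?_⟩
    rw [div_le_iff₀ (by linarith)]
    rw [div_le_iff₀ hρ0] at h2
    linarith
  obtain ⟨a1, a2, a3⟩ := block V.card hV
  obtain ⟨b1, b2, b3⟩ := block X.card hX
  have h := card_incidences_le_of_blocks U B V X hU _ _ a1 b1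
  have h' : ((incidences U B V X).card : ℝ) ≤ (U.card * B.card) *
      ((V.card / ⌈(V.card : ℝ) / ρ⌉₊ : ℕ) + (X.card / ⌈(X.card : ℝ) / ρ⌉₊ : ℕ) + 1)
      + V.card * X.card * (⌈(V.card : ℝ) / ρ⌉₊ * ⌈(X.card : ℝ) / ρ⌉₊) := by exact_mod_cast h
  refine h'.trans (add_le_add ?_ ?_)
  · calc _ ≤ (U.card * B.card : ℝ) * (3 * ρ) := mul_le_mul_of_nonneg_left (by linarith) hUB
      _ = _ := by ring
  · have : (⌈(V.card : ℝ) / ρ⌉₊ * ⌈(X.card : ℝ) / ρ⌉₊ : ℝ)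
        ≤ 2 * (V.card / ρ) * (2 * (X.card / ρ)) := by gcongr
    calc _ ≤ (V.card * X.card : ℝ) * (2 * (V.card / ρ) * (2 * (X.card / ρ))) := by gcongr
      _ = _ := by field_simp; ring

/-! ### Linear equations in three variables -/

/-- The solutions of `α a₁ + β a₂ = γ a₃` with `aᵢ ∈ Aᵢ`. -/
noncomputable def solutions (α β γ : ℝ) (A₁ A₂ A₃ : Finset ℝ) : Finset (ℝ × ℝ × ℝ) :=
  (A₁ ×ˢ A₂ ×ˢ A₃).filter (fun z => α * z.1 + β * z.2.1 = γ * z.2.2)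

lemma solutions_neg (α β γ : ℝ) (A₁ A₂ A₃ : Finset ℝ) :
    solutions (-α) (-β) (-γ) A₁ A₂ A₃ = solutions α β γ A₁ A₂ A₃ := by
  refine Finset.filter_congr fun z _ => ?_
  constructor <;> intro h <;> linarith

/-- If every element of `A₁` is a product `u v` in at least `m` ways, then each solution of
`α a₁ + β a₂ = γ a₃` is an incidence of `m` lines `x = (α u) v + β a₂` with points `(v, γ a₃)`. -/
lemma mul_card_solutions_le (A₁ A₂ A₃ U V : Finset ℝ) (m : ℕ) (hU : ∀ u ∈ U, 0 < u)
    (hm : ∀ a ∈ A₁, m ≤ ((U ×ˢ V).filter (fun p => p.1 * p.2 = a)).card)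
    (α β γ : ℝ) (hα : α ≠ 0) (hβ : β ≠ 0) (hγ : γ ≠ 0) (ρ : ℝ) (hρ : 1 ≤ ρ) :
    (m : ℝ) * (solutions α β γ A₁ A₂ A₃).card
      ≤ 3 * (U.card * A₂.card) * ρ + 4 * (V.card * A₃.card) ^ 2 / ρ ^ 2 := by
  wlog hα0 : 0 < α generalizing α β γ
  · rw [← solutions_neg]
    exact this (-α) (-β) (-γ) (neg_ne_zero.2 hα) (neg_ne_zero.2 hβ) (neg_ne_zero.2 hγ)
      (neg_pos.2 (lt_of_le_of_ne (not_lt.1 hα0) hα))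
  have hcU : (U.image (α * ·)).card = U.card :=
    Finset.card_image_of_injective _ (mul_right_injective₀ hα)
  have hcB : (A₂.image (β * ·)).card = A₂.card :=
    Finset.card_image_of_injective _ (mul_right_injective₀ hβ)
  have hcX : (A₃.image (γ * ·)).card = A₃.card :=
    Finset.card_image_of_injective _ (mul_right_injective₀ hγ)
  have key := card_incidences_le (U.image (α * ·)) (A₂.image (β * ·)) V (A₃.image (γ * ·))
    (by
      intro x hx
      obtain ⟨u, hu, rfl⟩ := Finset.mem_image.1 hx
      exact mul_pos hα0 (hU u hu)) ρ hρ
  rw [hcU, hcB, hcX] at key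
  refine le_trans ?_ key
  have : m * (solutions α β γ A₁ A₂ A₃).card ≤
      (incidences (U.image (α * ·)) (A₂.image (β * ·)) V (A₃.image (γ * ·))).card := by
    calc m * (solutions α β γ A₁ A₂ A₃).card
        = ∑ z ∈ solutions α β γ A₁ A₂ A₃, m := by rw [Finset.sum_const, smul_eq_mul, mul_comm]
      _ ≤ ∑ z ∈ solutions α β γ A₁ A₂ A₃,
            ((U ×ˢ V).filter (fun p => p.1 * p.2 = z.1)).card := by
          refine Finset.sum_le_sum fun z hz => hm _ ?_
          simp only [solutions, Finset.mem_filter, Finset.mem_product] at hz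
          exact hz.1.1
      _ = ((solutions α β γ A₁ A₂ A₃).sigma
            (fun z => (U ×ˢ V).filter (fun p => p.1 * p.2 = z.1))).card :=
          (Finset.card_sigma _ _).symm
      _ ≤ _ := by
          refine Finset.card_le_card_of_injOn
            (fun y => ((α * y.2.1, β * y.1.2.1), y.2.2)) ?_ ?_
          · rintro ⟨⟨a₁, a₂, a₃⟩, u, v⟩ hy
            simp only [Finset.coe_sigma, Set.mem_sigma_iff, Finset.mem_coe, solutions,
              Finset.mem_filter, Finset.mem_product] at hy
            obtain ⟨⟨⟨h1, h2, h3⟩, h4⟩, ⟨hu, hv⟩, h5⟩ := hy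
            simp only [incidences, Finset.mem_coe, Finset.mem_filter, Finset.mem_product]
            refine ⟨⟨⟨Finset.mem_image_of_mem _ hu, Finset.mem_image_of_mem _ h2⟩, hv⟩, ?_⟩
            have : α * u * v + β * a₂ = γ * a₃ := by rw [← h4, ← h5]; ring
            rw [this]
            exact Finset.mem_image_of_mem _ h3
          · rintro ⟨⟨a₁, a₂, a₃⟩, u, v⟩ hy ⟨⟨a₁', a₂', a₃'⟩, u', v'⟩ hy' h
            simp only [Finset.coe_sigma, Set.mem_sigma_iff, Finset.mem_coe, solutions,
              Finset.mem_filter, Finset.mem_product] at hy hy'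
            simp only [Prod.mk.injEq, mul_eq_mul_left_iff, hα, hβ, or_false] at h
            obtain ⟨⟨rfl, rfl⟩, rfl⟩ := h
            have e1 : a₁ = a₁' := hy.2.2.symm.trans hy'.2.2
            subst e1
            have e3 : a₃ = a₃' := mul_left_cancel₀ hγ (hy.1.2.symm.trans hy'.1.2)
            subst e3
            rfl
  exact_mod_cast this

/-! ### Sums of points on clusters of lines -/

/-- The pairs of slopes `l < l'` in `Γ`. -/
noncomputable def slopePairs (Γ : Finset ℝ) : Finset (ℝ × ℝ) :=
  (Γ ×ˢ Γ).filter (fun p => p.1 < p.2)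

lemma two_mul_card_slopePairs (Γ : Finset ℝ) :
    2 * (slopePairs Γ).card + Γ.card = Γ.card ^ 2 := by
  have h1 : (slopePairs Γ).card = ((Γ ×ˢ Γ).filter (fun p : ℝ × ℝ => p.2 < p.1)).card := by
    refine Finset.card_nbij' Prod.swap Prod.swap ?_ ?_ ?_ ?_ <;>
      · rintro ⟨a, b⟩ h
        simp_all [slopePairs]
  have h2 : Γ.card = ((Γ ×ˢ Γ).filter (fun p : ℝ × ℝ => p.1 = p.2)).card := by
    rw [← Finset.diag_card]
    congr 1
    ext ⟨a, b⟩
    simp only [Finset.mem_diag, Finset.mem_filter, Finset.mem_product]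
    constructor
    · rintro ⟨h, rfl⟩; exact ⟨⟨h, h⟩, rfl⟩
    · rintro ⟨⟨h, -⟩, h'⟩; exact ⟨h, h'⟩
  have h3 : Γ.card ^ 2 = (slopePairs Γ).card + (((Γ ×ˢ Γ).filter (fun p : ℝ × ℝ => p.2 < p.1)).card
      + ((Γ ×ˢ Γ).filter (fun p : ℝ × ℝ => p.1 = p.2)).card) := by
    rw [sq, ← Finset.card_product, ← Finset.card_union_of_disjoint, slopePairs,
      ← Finset.card_union_of_disjoint]
    · congr 1
      ext ⟨a, b⟩
      have := lt_trichotomy a b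
      simp only [Finset.mem_product, Finset.mem_union, Finset.mem_filter]
      tauto
    · rw [Finset.disjoint_left]
      rintro ⟨a, b⟩ h h'
      simp only [Finset.mem_union, Finset.mem_filter] at h h'
      rcases h' with h' | h' <;> linarith [h.2, h'.2]
    · rw [Finset.disjoint_left]
      rintro ⟨a, b⟩ h h'
      simp only [Finset.mem_filter] at h h'
      linarith [h.2, h'.2]
  omega

/-- The sum of the point with abscissa `x.1` on the line of slope `p.1` through the origin and the
point with abscissa `x.2` on the line of slope `p.2`. -/
def raySum (p x : ℝ × ℝ) : ℝ × ℝ := (x.1 + x.2, p.1 * x.1 + p.2 * x.2)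

/-- All sums of two points on different lines with slopes in `Γ`, where the points on the line of
slope `l` are those with abscissa in `F l`. -/
noncomputable def clusterSums (Γ : Finset ℝ) (F : ℝ → Finset ℝ) : Finset (ℝ × ℝ) :=
  (slopePairs Γ).biUnion (fun p => (F p.1 ×ˢ F p.2).image (raySum p))

/-- Sums coming from one pair of lines are distinct, the two lines being linearly independent. -/
lemma card_raySum_eq_self (p : ℝ × ℝ) (hp : p.1 ≠ p.2) (X : Finset (ℝ × ℝ)) :
    ((X ×ˢ X).filter (fun z => raySum p z.1 = raySum p z.2)).card ≤ X.card := by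
  refine Finset.card_le_card_of_injOn Prod.fst ?_ ?_
  · intro z hz
    exact (Finset.mem_product.1 (Finset.mem_filter.1 hz).1).1
  · have key : ∀ z : (ℝ × ℝ) × (ℝ × ℝ), raySum p z.1 = raySum p z.2 → z.1 = z.2 := by
      rintro ⟨⟨a, b⟩, ⟨c, d⟩⟩ h
      simp only [raySum, Prod.mk.injEq] at h ⊢
      have h1 : (p.1 - p.2) * (a - c) = 0 := by linear_combination h.2 - p.2 * h.1
      have h2 : a - c = 0 := (mul_eq_zero.1 h1).resolve_left (sub_ne_zero.2 hp)
      constructor <;> linarith [h.1]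
    intro z hz w hw h
    have e1 := key z (Finset.mem_filter.1 hz).2
    have e2 := key w (Finset.mem_filter.1 hw).2
    refine Prod.ext h ?_
    rw [← e1, ← e2]; exact h

/-- Collisions between two different pairs of lines. One of the four slopes is not in the other
pair; eliminating its variable leaves one equation in three variables with nonzero coefficients. -/
lemma card_raySum_eq_le (Γ : Finset ℝ) (F : ℝ → Finset ℝ) (T : ℝ)
    (hT : ∀ l₁ ∈ Γ, ∀ l₂ ∈ Γ, ∀ l₃ ∈ Γ, ∀ α β γ : ℝ, α ≠ 0 → β ≠ 0 → γ ≠ 0 →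
      ((solutions α β γ (F l₁) (F l₂) (F l₃)).card : ℝ) ≤ T)
    (p q : ℝ × ℝ) (hp : p ∈ slopePairs Γ) (hq : q ∈ slopePairs Γ) (hpq : p ≠ q) :
    ((((F p.1 ×ˢ F p.2) ×ˢ (F q.1 ×ˢ F q.2)).filter
      (fun z => raySum p z.1 = raySum q z.2)).card : ℝ) ≤ T := by
  obtain ⟨p₁, p₂⟩ := p
  obtain ⟨q₁, q₂⟩ := q
  simp only [slopePairs, Finset.mem_filter, Finset.mem_product] at hp hq
  by_cases h : q₂ = p₁ ∨ q₂ = p₂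
  · have h1 : p₁ - q₁ ≠ 0 ∧ p₂ - q₁ ≠ 0 := by
      rw [sub_ne_zero, sub_ne_zero]
      constructor <;> rintro rfl <;> rcases h with rfl | rfl
      · exact lt_irrefl _ hq.2
      · exact hpq rfl
      · exact lt_asymm hp.2 hq.2
      · exact lt_irrefl _ hq.2
    refine le_trans ?_ (hT p₁ hp.1.1 p₂ hp.1.2 q₂ hq.1.2 (p₁ - q₁) (p₂ - q₁) (q₂ - q₁) h1.1 h1.2
      (sub_ne_zero.2 hq.2.ne'))
    refine Nat.cast_le.2 (Finset.card_le_card_of_injOn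
      (fun z => (z.1.1, z.1.2, z.2.2)) ?_ ?_)
    · rintro ⟨⟨a, b⟩, ⟨c, d⟩⟩ hz
      simp only [Finset.coe_filter, Finset.mem_product, Set.mem_ofPred_eq, raySum,
        Prod.mk.injEq] at hz
      simp only [solutions, Finset.coe_filter, Finset.mem_product, Set.mem_ofPred_eq]
      refine ⟨⟨hz.1.1.1, hz.1.1.2, hz.1.2.2⟩, ?_⟩
      linear_combination hz.2.2 - q₁ * hz.2.1
    · rintro ⟨⟨a, b⟩, ⟨c, d⟩⟩ hz ⟨⟨a', b'⟩, ⟨c', d'⟩⟩ hz' e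
      simp only [Finset.coe_filter, Finset.mem_product, Set.mem_ofPred_eq, raySum,
        Prod.mk.injEq] at hz hz' e ⊢
      obtain ⟨rfl, rfl, rfl⟩ := e
      exact ⟨⟨rfl, rfl⟩, by linarith [hz.2.1, hz'.2.1], rfl⟩
  · push Not at h
    refine le_trans ?_ (hT p₁ hp.1.1 p₂ hp.1.2 q₁ hq.1.1 (p₁ - q₂) (p₂ - q₂) (q₁ - q₂)
      (sub_ne_zero.2 h.1.symm) (sub_ne_zero.2 h.2.symm) (sub_ne_zero.2 hq.2.ne))
    refine Nat.cast_le.2 (Finset.card_le_card_of_injOn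
      (fun z => (z.1.1, z.1.2, z.2.1)) ?_ ?_)
    · rintro ⟨⟨a, b⟩, ⟨c, d⟩⟩ hz
      simp only [Finset.coe_filter, Finset.mem_product, Set.mem_ofPred_eq, raySum,
        Prod.mk.injEq] at hz
      simp only [solutions, Finset.coe_filter, Finset.mem_product, Set.mem_ofPred_eq]
      refine ⟨⟨hz.1.1.1, hz.1.1.2, hz.1.2.1⟩, ?_⟩
      linear_combination hz.2.2 - q₂ * hz.2.1
    · rintro ⟨⟨a, b⟩, ⟨c, d⟩⟩ hz ⟨⟨a', b'⟩, ⟨c', d'⟩⟩ hz' e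
      simp only [Finset.coe_filter, Finset.mem_product, Set.mem_ofPred_eq, raySum,
        Prod.mk.injEq] at hz hz' e ⊢
      obtain ⟨rfl, rfl, rfl⟩ := e
      exact ⟨⟨rfl, rfl⟩, rfl, by linarith [hz.2.1, hz'.2.1]⟩

/-- Cauchy–Schwarz for the representation function of a map. -/
lemma card_sq_le_card_image_mul {α β : Type*} [DecidableEq β] (W : Finset α) (s : α → β) :
    W.card ^ 2 ≤ (W.image s).card * ((W ×ˢ W).filter (fun z => s z.1 = s z.2)).card := by
  have h1 : W.card = ∑ c ∈ W.image s, (W.filter (fun w => s w = c)).card :=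
    Finset.card_eq_sum_card_image s W
  have h2 : ((W ×ˢ W).filter (fun z => s z.1 = s z.2)).card
      = ∑ c ∈ W.image s, (W.filter (fun w => s w = c)).card ^ 2 := by
    rw [Finset.card_eq_sum_card_fiberwise (f := fun z => s z.1) (t := W.image s)]
    · refine Finset.sum_congr rfl fun c _ => ?_
      rw [sq, ← Finset.card_product]
      congr 1
      ext ⟨a, b⟩
      simp only [Finset.mem_filter, Finset.mem_product]
      constructor
      · rintro ⟨⟨⟨ha, hb⟩, h⟩, hc⟩
        exact ⟨⟨ha, hc⟩, hb, h ▸ hc⟩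
      · rintro ⟨⟨ha, hc⟩, hb, hc'⟩
        exact ⟨⟨⟨ha, hb⟩, hc.trans hc'.symm⟩, hc⟩
    · intro z hz
      simp only [Finset.coe_filter, Finset.mem_product, Set.mem_ofPred_eq] at hz
      exact Finset.mem_coe.2 (Finset.mem_image_of_mem s hz.1.1)
  rw [h2]
  conv_lhs => rw [h1]
  exact sq_sum_le_card_mul_sum_sq

/-- If the collisions do not outnumber the diagonal, a cluster of `M` lines with `n` points each
spans `≫ M ^ 2 n ^ 2` sums. A cluster of two lines has no collisions at all. -/
lemma card_clusterSums_ge (Γ : Finset ℝ) (F : ℝ → Finset ℝ) (n M : ℕ) (T : ℝ)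
    (hF : ∀ l ∈ Γ, (F l).card = n)
    (hT : ∀ l₁ ∈ Γ, ∀ l₂ ∈ Γ, ∀ l₃ ∈ Γ, ∀ α β γ : ℝ, α ≠ 0 → β ≠ 0 → γ ≠ 0 →
      ((solutions α β γ (F l₁) (F l₂) (F l₃)).card : ℝ) ≤ T)
    (hΓ : Γ.card = M) (hM : 2 ≤ M) (hMT : M = 2 ∨ (M : ℝ) ^ 2 * T ≤ (n : ℝ) ^ 2) :
    (M : ℝ) ^ 2 * n ^ 2 ≤ 8 * (clusterSums Γ F).card := by
  rcases Nat.eq_zero_or_pos n with rfl | hn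
  · simp
  let W : Finset (Σ _ : ℝ × ℝ, ℝ × ℝ) := (slopePairs Γ).sigma (fun p => F p.1 ×ˢ F p.2)
  let s : (Σ _ : ℝ × ℝ, ℝ × ℝ) → ℝ × ℝ := fun w => raySum w.1 w.2
  set P := (slopePairs Γ).card with hP
  have hpair : 2 * P + M = M ^ 2 := by rw [← hΓ]; exact two_mul_card_slopePairs Γ
  have hmem : ∀ p ∈ slopePairs Γ, p.1 ∈ Γ ∧ p.2 ∈ Γ ∧ p.1 < p.2 := by
    intro p hp
    simp only [slopePairs, Finset.mem_filter, Finset.mem_product] at hp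
    exact ⟨hp.1.1, hp.1.2, hp.2⟩
  have hcard : ∀ p ∈ slopePairs Γ, (F p.1 ×ˢ F p.2).card = n ^ 2 := by
    intro p hp
    rw [Finset.card_product, hF _ (hmem p hp).1, hF _ (hmem p hp).2.1, sq]
  have hW : W.card = P * n ^ 2 := by
    rw [Finset.card_sigma, Finset.sum_congr rfl hcard, Finset.sum_const, smul_eq_mul]
  have hZ : W.image s = clusterSums Γ F := by
    ext z
    simp only [W, s, clusterSums, Finset.mem_image, Finset.mem_sigma, Finset.mem_biUnion]
    constructor
    · rintro ⟨⟨p, x⟩, ⟨hp, hx⟩, rfl⟩; exact ⟨p, hp, x, hx, rfl⟩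
    · rintro ⟨p, hp, x, hx, rfl⟩; exact ⟨⟨p, x⟩, ⟨hp, hx⟩, rfl⟩
  have hT0 : 0 ≤ T := by
    obtain ⟨l, hl⟩ : Γ.Nonempty := Finset.card_pos.1 (by omega)
    exact (Nat.cast_nonneg _).trans
      (hT l hl l hl l hl 1 1 1 one_ne_zero one_ne_zero one_ne_zero)
  have hcoll : (((W ×ˢ W).filter (fun z => s z.1 = s z.2)).card : ℝ)
      ≤ P * n ^ 2 + (P ^ 2 - P) * T := by
    have e : ((W ×ˢ W).filter (fun z => s z.1 = s z.2)).card
        = ∑ y ∈ slopePairs Γ ×ˢ slopePairs Γ, (((F y.1.1 ×ˢ F y.1.2) ×ˢ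
          (F y.2.1 ×ˢ F y.2.2)).filter (fun z => raySum y.1 z.1 = raySum y.2 z.2)).card := by
      rw [← Finset.card_sigma]
      refine Finset.card_nbij' (fun z => ⟨(z.1.1, z.2.1), (z.1.2, z.2.2)⟩)
        (fun y => (⟨y.1.1, y.2.1⟩, ⟨y.1.2, y.2.2⟩)) ?_ ?_ ?_ ?_
      · rintro ⟨⟨p, x⟩, ⟨q, y⟩⟩ h
        simp only [W, s, Finset.coe_filter, Finset.mem_product, Finset.mem_sigma,
          Set.mem_ofPred_eq, Finset.coe_sigma, Set.mem_sigma_iff, Finset.coe_product,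
          Set.mem_prod, Finset.mem_coe] at h ⊢
        tauto
      · rintro ⟨⟨p, q⟩, ⟨x, y⟩⟩ h
        simp only [W, s, Finset.coe_filter, Finset.mem_product, Finset.mem_sigma,
          Set.mem_ofPred_eq, Finset.coe_sigma, Set.mem_sigma_iff, Finset.coe_product,
          Set.mem_prod, Finset.mem_coe] at h ⊢
        tauto
      · rintro ⟨⟨p, x⟩, ⟨q, y⟩⟩ _; rfl
      · rintro ⟨⟨p, q⟩, ⟨x, y⟩⟩ _; rfl
    rw [e, ← Finset.filter_union_filter_not_eq (fun y : (ℝ × ℝ) × (ℝ × ℝ) => y.1 = y.2)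
      (slopePairs Γ ×ˢ slopePairs Γ),
      Finset.sum_union (Finset.disjoint_filter_filter_not _ _ _)]
    have hdiag : (slopePairs Γ ×ˢ slopePairs Γ).filter (fun y => y.1 = y.2)
        = (slopePairs Γ).diag := by
      ext ⟨a, b⟩
      simp only [Finset.mem_diag, Finset.mem_filter, Finset.mem_product]
      constructor
      · rintro ⟨⟨h, -⟩, h'⟩; exact ⟨h, h'⟩
      · rintro ⟨h, rfl⟩; exact ⟨⟨h, h⟩, rfl⟩
    have hoff : (slopePairs Γ ×ˢ slopePairs Γ).filter (fun y => ¬ y.1 = y.2)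
        = (slopePairs Γ).offDiag := by
      ext ⟨a, b⟩
      simp only [Finset.mem_offDiag, Finset.mem_filter, Finset.mem_product]
      tauto
    rw [hdiag, hoff]
    push_cast
    refine add_le_add ?_ ?_
    · have : ∀ y ∈ (slopePairs Γ).diag, (((((F y.1.1 ×ˢ F y.1.2) ×ˢ
          (F y.2.1 ×ˢ F y.2.2)).filter (fun z => raySum y.1 z.1 = raySum y.2 z.2)).card : ℕ) : ℝ)
          ≤ (n : ℝ) ^ 2 := by
        rintro ⟨p, q⟩ h
        obtain ⟨hp, rfl : p = q⟩ := Finset.mem_diag.1 h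
        have := card_raySum_eq_self p (hmem p hp).2.2.ne (F p.1 ×ˢ F p.2)
        rw [hcard p hp] at this
        exact_mod_cast this
      have := Finset.sum_le_card_nsmul _ _ _ this
      rwa [Finset.diag_card, nsmul_eq_mul] at this
    · have : ∀ y ∈ (slopePairs Γ).offDiag, (((((F y.1.1 ×ˢ F y.1.2) ×ˢ
          (F y.2.1 ×ˢ F y.2.2)).filter (fun z => raySum y.1 z.1 = raySum y.2 z.2)).card : ℕ) : ℝ)
          ≤ T := by
        rintro ⟨p, q⟩ h
        obtain ⟨hp, hq, hpq⟩ := Finset.mem_offDiag.1 h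
        exact card_raySum_eq_le Γ F T hT p q hp hq hpq
      have := Finset.sum_le_card_nsmul _ _ _ this
      rw [Finset.offDiag_card, nsmul_eq_mul, Nat.cast_sub (Nat.le_mul_self _)] at this
      push_cast at this
      rw [sq]
      exact this
  have hPpos : 1 ≤ P := by nlinarith
  have hPR : (1 : ℝ) ≤ P := by exact_mod_cast hPpos
  have hpairR : 2 * (P : ℝ) + M = (M : ℝ) ^ 2 := by exact_mod_cast hpair
  have hMR : (2 : ℝ) ≤ M := by exact_mod_cast hM
  have hoffT : ((P : ℝ) ^ 2 - P) * T ≤ P * n ^ 2 := by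
    rcases hMT with h2 | h2
    · subst h2
      have : (P : ℝ) = 1 := by push_cast at hpairR; linarith
      rw [this]; simp
    · have : ((P : ℝ) ^ 2 - P) * T ≤ P * (M ^ 2 * T) := by
        have : (P : ℝ) ^ 2 - P ≤ P * M ^ 2 := by nlinarith
        nlinarith [mul_le_mul_of_nonneg_right this hT0]
      exact this.trans (mul_le_mul_of_nonneg_left h2 (by linarith))
  have hcs := card_sq_le_card_image_mul W s
  rw [hZ, hW] at hcs
  have hcsR : ((P : ℝ) * n ^ 2) ^ 2 ≤ (clusterSums Γ F).card *
      ((W ×ˢ W).filter (fun z => s z.1 = s z.2)).card := by exact_mod_cast hcs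
  have hnR : (0 : ℝ) < n := by exact_mod_cast hn
  have hpos : 0 < (P : ℝ) * n ^ 2 := by positivity
  have h3 : ((P : ℝ) * n ^ 2) * (P * n ^ 2) ≤ (2 * (clusterSums Γ F).card) * (P * n ^ 2) := by
    have := mul_le_mul_of_nonneg_left (hcoll.trans (add_le_add_right hoffT _))
      (Nat.cast_nonneg (clusterSums Γ F).card : (0 : ℝ) ≤ _)
    nlinarith
  have h4 := le_of_mul_le_mul_right h3 hpos
  have h5 : (M : ℝ) ^ 2 ≤ 4 * P := by nlinarith
  nlinarith [mul_le_mul_of_nonneg_right h5 (sq_nonneg (n : ℝ))]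

/-- A sum of points on two lines through the origin lies strictly between the lines. -/
lemma exists_lt_lt_of_mem_clusterSums {Γ : Finset ℝ} {F : ℝ → Finset ℝ}
    (hpos : ∀ l ∈ Γ, ∀ a ∈ F l, 0 < a) {z : ℝ × ℝ} (hz : z ∈ clusterSums Γ F) :
    ∃ l ∈ Γ, ∃ l' ∈ Γ, l * z.1 < z.2 ∧ z.2 < l' * z.1 ∧ 0 < z.1 := by
  simp only [clusterSums, slopePairs, Finset.mem_biUnion, Finset.mem_filter, Finset.mem_product,
    Finset.mem_image] at hz
  obtain ⟨⟨l, l'⟩, ⟨⟨hl, hl'⟩, hlt⟩, ⟨a, b⟩, ⟨ha, hb⟩, rfl⟩ := hz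
  have ha0 := hpos l hl a ha
  have hb0 := hpos l' hl' b hb
  refine ⟨l, hl, l', hl', ?_, ?_, ?_⟩ <;> simp only [raySum]
  · nlinarith [mul_lt_mul_of_pos_right hlt hb0]
  · nlinarith [mul_lt_mul_of_pos_right hlt ha0]
  · linarith

lemma clusterSums_subset {A Γ : Finset ℝ} {F : ℝ → Finset ℝ}
    (hFA : ∀ l ∈ Γ, ∀ a ∈ F l, a ∈ A ∧ l * a ∈ A) :
    clusterSums Γ F ⊆ (A + A) ×ˢ (A + A) := by
  intro z hz
  simp only [clusterSums, slopePairs, Finset.mem_biUnion, Finset.mem_filter, Finset.mem_product,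
    Finset.mem_image] at hz
  obtain ⟨⟨l, l'⟩, ⟨⟨hl, hl'⟩, -⟩, ⟨a, b⟩, ⟨ha, hb⟩, rfl⟩ := hz
  exact Finset.mem_product.2 ⟨Finset.add_mem_add (hFA l hl a ha).1 (hFA l' hl' b hb).1,
    Finset.add_mem_add (hFA l hl a ha).2 (hFA l' hl' b hb).2⟩

/-- Clusters of `M` consecutive slopes occupy disjoint sectors of the plane, so their sums add up
inside `(A + A) × (A + A)`. -/
lemma mul_card_mul_sq_le (A Λ : Finset ℝ) (F : ℝ → Finset ℝ) (n M : ℕ) (T : ℝ)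
    (hF : ∀ l ∈ Λ, (F l).card = n) (hpos : ∀ l ∈ Λ, ∀ a ∈ F l, 0 < a)
    (hFA : ∀ l ∈ Λ, ∀ a ∈ F l, a ∈ A ∧ l * a ∈ A)
    (hT : ∀ l₁ ∈ Λ, ∀ l₂ ∈ Λ, ∀ l₃ ∈ Λ, ∀ α β γ : ℝ, α ≠ 0 → β ≠ 0 → γ ≠ 0 →
      ((solutions α β γ (F l₁) (F l₂) (F l₃)).card : ℝ) ≤ T)
    (hM : 2 ≤ M) (hMΛ : M ≤ Λ.card) (hMT : M = 2 ∨ (M : ℝ) ^ 2 * T ≤ (n : ℝ) ^ 2) :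
    (M : ℝ) * Λ.card * n ^ 2 ≤ 16 * ((A + A).card : ℝ) ^ 2 := by
  set r := Λ.card / M with hr
  have hM0 : 0 < M := by omega
  have hrM : r * M ≤ Λ.card := Nat.div_mul_le_self _ _
  let e : Fin Λ.card ↪o ℝ := Λ.orderEmbOfFin rfl
  have he : ∀ i, e i ∈ Λ := Λ.orderEmbOfFin_mem rfl
  have hlt : ∀ (j : Fin r) (k : Fin M), (j : ℕ) * M + k < Λ.card := by
    intro j k
    have h1 : ((j : ℕ) + 1) * M ≤ r * M := Nat.mul_le_mul_right _ j.2
    have h2 := k.2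
    rw [add_mul] at h1
    omega
  let Γ : Fin r → Finset ℝ := fun j => Finset.univ.image (fun k : Fin M => e ⟨j * M + k, hlt j k⟩)
  have hΓsub : ∀ j, Γ j ⊆ Λ := by
    intro j l hl
    obtain ⟨k, -, rfl⟩ := Finset.mem_image.1 hl
    exact he _
  have hΓcard : ∀ j, (Γ j).card = M := by
    intro j
    rw [Finset.card_image_of_injective, Finset.card_univ, Fintype.card_fin]
    intro k k' h
    have := e.injective h
    simp only [Fin.mk.injEq] at this
    exact Fin.ext (by omega)
  have hord : ∀ j j', j < j' → ∀ l ∈ Γ j, ∀ l' ∈ Γ j', l < l' := by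
    intro j j' hjj l hl l' hl'
    obtain ⟨k, -, rfl⟩ := Finset.mem_image.1 hl
    obtain ⟨k', -, rfl⟩ := Finset.mem_image.1 hl'
    refine e.strictMono ?_
    rw [Fin.mk_lt_mk]
    have h1 : ((j : ℕ) + 1) * M ≤ j' * M := Nat.mul_le_mul_right _ hjj
    have h2 := k.2
    rw [add_mul] at h1
    omega
  have hdisj : ∀ j j', j < j' → Disjoint (clusterSums (Γ j) F) (clusterSums (Γ j') F) := by
    intro j j' hjj
    rw [Finset.disjoint_left]
    intro z hz hz'
    obtain ⟨-, -, l, hl, -, h1, h0⟩ :=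
      exists_lt_lt_of_mem_clusterSums (fun l hl => hpos l (hΓsub j hl)) hz
    obtain ⟨l', hl', -, -, h2, -⟩ :=
      exists_lt_lt_of_mem_clusterSums (fun l hl => hpos l (hΓsub j' hl)) hz'
    have := mul_lt_mul_of_pos_right (hord j j' hjj l hl l' hl') h0
    linarith
  have hsum : ∑ j, (clusterSums (Γ j) F).card ≤ (A + A).card ^ 2 := by
    rw [sq, ← Finset.card_product, ← Finset.card_biUnion]
    · refine Finset.card_le_card (Finset.biUnion_subset.2 fun j _ => ?_)
      exact clusterSums_subset fun l hl => hFA l (hΓsub j hl)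
    · intro j _ j' _ hne
      rcases lt_or_gt_of_ne hne with h | h
      · exact hdisj j j' h
      · exact (hdisj j' j h).symm
  have hsumR : ∑ j, ((clusterSums (Γ j) F).card : ℝ) ≤ ((A + A).card : ℝ) ^ 2 := by
    exact_mod_cast hsum
  have hlow : (r : ℝ) * (M ^ 2 * n ^ 2) ≤ ∑ j : Fin r, 8 * ((clusterSums (Γ j) F).card : ℝ) := by
    have : ∀ j ∈ (Finset.univ : Finset (Fin r)),
        (M : ℝ) ^ 2 * n ^ 2 ≤ 8 * ((clusterSums (Γ j) F).card : ℝ) := fun j _ =>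
      card_clusterSums_ge (Γ j) F n M T (fun l hl => hF l (hΓsub j hl))
        (fun l₁ h₁ l₂ h₂ l₃ h₃ => hT l₁ (hΓsub j h₁) l₂ (hΓsub j h₂) l₃ (hΓsub j h₃))
        (hΓcard j) hM hMT
    have := Finset.card_nsmul_le_sum _ _ _ this
    rwa [Finset.card_univ, Fintype.card_fin, nsmul_eq_mul] at this
  rw [← Finset.mul_sum] at hlow
  have hrr : Λ.card ≤ 2 * (r * M) := by
    have h1 := Nat.div_add_mod Λ.card M
    have h2 := Nat.mod_lt Λ.card hM0
    have h3 : 1 ≤ r := (Nat.one_le_div_iff hM0).2 hMΛ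
    rw [mul_comm, ← hr] at h1
    nlinarith
  have hrrR : (Λ.card : ℝ) ≤ 2 * (r * M) := by exact_mod_cast hrr
  have : (0 : ℝ) ≤ M * n ^ 2 := by positivity
  nlinarith [mul_le_mul_of_nonneg_left hrrR this]

/-! ### Slopes with many representations -/

/-- The abscissas of the points of `A × A` on the line of slope `l` through the origin. -/
noncomputable def slopeFiber (A : Finset ℝ) (l : ℝ) : Finset ℝ :=
  A.filter (fun a => l * a ∈ A)

lemma mem_slopeFiber {A : Finset ℝ} {l a : ℝ} : a ∈ slopeFiber A l ↔ a ∈ A ∧ l * a ∈ A :=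
  Finset.mem_filter

lemma pos_of_mem_div {A : Finset ℝ} (hA : ∀ a ∈ A, 0 < a) {x : ℝ} (hx : x ∈ A / A) : 0 < x := by
  obtain ⟨a, ha, b, hb, rfl⟩ := Finset.mem_div.1 hx
  exact div_pos (hA a ha) (hA b hb)

/-- Every ordered pair of `A` lies on exactly one line through the origin. -/
lemma sum_card_slopeFiber (A : Finset ℝ) (hA : ∀ a ∈ A, 0 < a) :
    ∑ l ∈ A / A, (slopeFiber A l).card = A.card ^ 2 := by
  rw [sq, ← Finset.card_product,
    Finset.card_eq_sum_card_fiberwise (f := fun z : ℝ × ℝ => z.1 / z.2) (t := A / A)]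
  · refine Finset.sum_congr rfl fun l _ => ?_
    refine Finset.card_nbij' (fun a => (l * a, a)) Prod.snd ?_ ?_ ?_ ?_
    · intro a ha
      obtain ⟨h1, h2⟩ := mem_slopeFiber.1 ha
      have := (hA a h1).ne'
      simp only [Finset.coe_filter, Finset.mem_product, Set.mem_ofPred_eq]
      exact ⟨⟨h2, h1⟩, by field_simp⟩
    · rintro ⟨b, a⟩ h
      simp only [Finset.coe_filter, Finset.mem_product, Set.mem_ofPred_eq] at h
      obtain ⟨⟨h1, h2⟩, rfl⟩ := h
      refine mem_slopeFiber.2 ⟨h2, ?_⟩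
      rw [div_mul_cancel₀ _ (hA a h2).ne']
      exact h1
    · intro a _; rfl
    · rintro ⟨b, a⟩ h
      simp only [Finset.coe_filter, Finset.mem_product, Set.mem_ofPred_eq] at h
      obtain ⟨⟨h1, h2⟩, rfl⟩ := h
      simp only
      rw [div_mul_cancel₀ _ (hA a h2).ne']
  · rintro ⟨b, a⟩ h
    rw [Finset.mem_coe, Finset.mem_product] at h
    exact Finset.mem_coe.2 (Finset.div_mem_div h.1 h.2)

/-- The Katz–Koester inclusion: if `a` and `l a` are in `A`, then `a / c` and `l (a / c)` are
quotients of `A` for every `c ∈ A`. -/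
lemma div_mem_slopeFiber_div {A : Finset ℝ} {l a c : ℝ} (ha : a ∈ slopeFiber A l) (hc : c ∈ A) :
    a / c ∈ slopeFiber (A / A) l := by
  obtain ⟨h1, h2⟩ := mem_slopeFiber.1 ha
  refine mem_slopeFiber.2 ⟨Finset.div_mem_div h1 hc, ?_⟩
  rw [← mul_div_assoc]
  exact Finset.div_mem_div h2 hc

lemma card_le_card_slopeFiber_div {A : Finset ℝ} (hA : ∀ a ∈ A, 0 < a) {l : ℝ}
    (hl : (slopeFiber A l).Nonempty) : A.card ≤ (slopeFiber (A / A) l).card := by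
  obtain ⟨a, ha⟩ := hl
  refine Finset.card_le_card_of_injOn (fun c => a / c) (fun c hc => ?_) ?_
  · exact div_mem_slopeFiber_div ha hc
  · intro c hc d hd h
    have ha0 := (hA a (mem_slopeFiber.1 ha).1).ne'
    have hc0 := (hA c hc).ne'
    have hd0 := (hA d hd).ne'
    simp only at h
    field_simp at h
    exact h.symm

/-- Dyadic pigeonholing over the slopes: a class of slopes `l` that carries a `1 / log ^ 2`
proportion of `A × A` and on which `|A ∩ l A|` and `|(A / A) ∩ l (A / A)|` are constant up to a
factor `2`. -/
lemma exists_dyadic_class (A : Finset ℝ) (hA : ∀ a ∈ A, 0 < a) (hne : A.Nonempty) :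
    ∃ (Λ : Finset ℝ) (t q : ℕ), 1 ≤ t ∧
      (∀ l ∈ Λ, t ≤ (slopeFiber A l).card ∧ (slopeFiber A l).card ≤ 2 * t) ∧
      (∀ l ∈ Λ, q ≤ (slopeFiber (A / A) l).card ∧ (slopeFiber (A / A) l).card ≤ 2 * q) ∧
      A.card ^ 2 ≤ 4 * (A / A).card * t ∧
      A.card ^ 2 ≤ 4 * (Nat.log 2 A.card + 1) ^ 2 * ∑ l ∈ Λ, (slopeFiber A l).card := by
  set N := A.card with hN
  set L := Nat.log 2 N + 1 with hL
  set Q := A / A with hQ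
  have hN0 : 0 < N := hne.card_pos
  have hQne : Q.Nonempty := hne.div hne
  let r : ℝ → ℕ := fun l => (slopeFiber A l).card
  let s : ℝ → ℕ := fun l => (slopeFiber Q l).card
  let Λ₁ := Q.filter (fun l => N ^ 2 ≤ 2 * Q.card * r l)
  have hΛ₁ : N ^ 2 ≤ 2 * ∑ l ∈ Λ₁, r l := by
    have h1 : ∑ l ∈ Λ₁, r l +
        ∑ l ∈ Q.filter (fun l => ¬ N ^ 2 ≤ 2 * Q.card * r l), r l = N ^ 2 := by
      rw [Finset.sum_filter_add_sum_filter_not]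
      exact sum_card_slopeFiber A hA
    have h2 : 2 * Q.card * ∑ l ∈ Q.filter (fun l => ¬ N ^ 2 ≤ 2 * Q.card * r l), r l
        ≤ Q.card * N ^ 2 := by
      rw [Finset.mul_sum]
      refine (Finset.sum_le_card_nsmul _ _ (N ^ 2) fun l hl => ?_).trans ?_
      · exact (not_le.1 (Finset.mem_filter.1 hl).2).le
      · rw [smul_eq_mul]
        exact Nat.mul_le_mul_right _ (Finset.card_filter_le _ _)
    have h3 : 2 * ∑ l ∈ Q.filter (fun l => ¬ N ^ 2 ≤ 2 * Q.card * r l), r l ≤ N ^ 2 := by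
      refine Nat.le_of_mul_le_mul_left ?_ hQne.card_pos
      calc _ = 2 * Q.card * ∑ l ∈ Q.filter (fun l => ¬ N ^ 2 ≤ 2 * Q.card * r l), r l := by ring
        _ ≤ _ := h2
    omega
  have hNL : N < 2 ^ L := Nat.lt_pow_succ_log_self (by norm_num) N
  have hrpos : ∀ l ∈ Λ₁, r l ≠ 0 := by
    intro l hl h0
    have := (Finset.mem_filter.1 hl).2
    rw [h0, mul_zero] at this
    exact absurd this (pow_pos hN0 2).not_ge
  have hspos : ∀ l ∈ Λ₁, s l ≠ 0 := by
    intro l hl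
    have := card_le_card_slopeFiber_div hA
      (Finset.card_pos.1 (Nat.pos_of_ne_zero (hrpos l hl)))
    have : N ≤ s l := this
    omega
  have hmaps : ∀ l ∈ Λ₁, (Nat.log 2 (r l), Nat.log 2 (s l)) ∈
      Finset.range L ×ˢ Finset.range (2 * L) := by
    intro l hl
    rw [Finset.mem_product, Finset.mem_range, Finset.mem_range]
    constructor
    · refine Nat.log_lt_of_lt_pow (hrpos l hl) (lt_of_le_of_lt ?_ hNL)
      exact Finset.card_filter_le _ _
    · refine Nat.log_lt_of_lt_pow (b := 2) (x := 2 * L) (hspos l hl) ?_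
      calc s l ≤ Q.card := Finset.card_filter_le _ _
        _ ≤ N * N := Finset.card_div_le
        _ < 2 ^ L * 2 ^ L := Nat.mul_lt_mul'' hNL hNL
        _ = 2 ^ (2 * L) := by ring
  have hTne : (Finset.range L ×ˢ Finset.range (2 * L)).Nonempty := by
    rw [Finset.nonempty_product, Finset.nonempty_range_iff, Finset.nonempty_range_iff]
    omega
  obtain ⟨⟨i, j⟩, -, hij⟩ :
      ∃ y ∈ Finset.range L ×ˢ Finset.range (2 * L), N ^ 2 ≤ 4 * L ^ 2 *
        ∑ l ∈ Λ₁.filter (fun l => (Nat.log 2 (r l), Nat.log 2 (s l)) = y), r l := by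
    by_contra! hcon
    have h1 := Finset.sum_lt_sum_of_nonempty hTne hcon
    rw [← Finset.mul_sum, Finset.sum_fiberwise_of_maps_to hmaps, Finset.sum_const,
      Finset.card_product, Finset.card_range, Finset.card_range, smul_eq_mul] at h1
    have := Nat.mul_le_mul_left (2 * L ^ 2) hΛ₁
    have e1 : L * (2 * L) * N ^ 2 = 2 * L ^ 2 * N ^ 2 := by ring
    have e2 : 2 * L ^ 2 * (2 * ∑ l ∈ Λ₁, r l) = 4 * L ^ 2 * ∑ l ∈ Λ₁, r l := by ring
    omega
  set Λ := Λ₁.filter (fun l => (Nat.log 2 (r l), Nat.log 2 (s l)) = (i, j)) with hΛ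
  have hΛne : Λ.Nonempty := by
    rw [Finset.nonempty_iff_ne_empty]
    intro h
    rw [h, Finset.sum_empty, mul_zero] at hij
    exact absurd hij (pow_pos hN0 2).not_ge
  have hΛmem : ∀ l ∈ Λ, l ∈ Λ₁ ∧ Nat.log 2 (r l) = i ∧ Nat.log 2 (s l) = j := by
    intro l hl
    have := Finset.mem_filter.1 hl
    simpa using this
  have hr2 : ∀ l ∈ Λ, 2 ^ i ≤ r l ∧ r l ≤ 2 * 2 ^ i := by
    intro l hl
    obtain ⟨h1, h2, -⟩ := hΛmem l hl
    have h3 := Nat.pow_log_le_self 2 (hrpos l h1)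
    have h4 := Nat.lt_pow_succ_log_self (b := 2) (by norm_num) (r l)
    rw [h2] at h3 h4
    rw [pow_succ] at h4
    omega
  have hs2 : ∀ l ∈ Λ, 2 ^ j ≤ s l ∧ s l ≤ 2 * 2 ^ j := by
    intro l hl
    obtain ⟨h1, -, h2⟩ := hΛmem l hl
    have h3 := Nat.pow_log_le_self 2 (hspos l h1)
    have h4 := Nat.lt_pow_succ_log_self (b := 2) (by norm_num) (s l)
    rw [h2] at h3 h4
    rw [pow_succ] at h4
    omega
  refine ⟨Λ, 2 ^ i, 2 ^ j, Nat.one_le_two_pow, hr2, hs2, ?_, hij⟩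
  obtain ⟨l, hl⟩ := hΛne
  calc N ^ 2 ≤ 2 * Q.card * r l := (Finset.mem_filter.1 (hΛmem l hl).1).2
    _ ≤ 2 * Q.card * (2 * 2 ^ i) := Nat.mul_le_mul_left _ (hr2 l hl).2
    _ = _ := by ring

/-- For many slopes `l ∈ Λ` a single `c ∈ A` links a large part of `A ∩ l⁻¹ A` through slopes of
`Λ`. This is Cauchy–Schwarz: pairs of slopes of `Λ` through a common abscissa are plentiful. -/
lemma exists_linked_slopes (A Λ : Finset ℝ) (hA : ∀ a ∈ A, 0 < a) (hne : A.Nonempty) (t L : ℕ)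
    (ht : 1 ≤ t) (hL : 1 ≤ L)
    (hΛ : ∀ l ∈ Λ, t ≤ (slopeFiber A l).card ∧ (slopeFiber A l).card ≤ 2 * t)
    (hg : A.card ^ 2 ≤ 4 * L ^ 2 * ∑ l ∈ Λ, (slopeFiber A l).card) :
    ∃ (Λ' : Finset ℝ) (n : ℕ), Λ' ⊆ Λ ∧ 1 ≤ n ∧ t ≤ 8 * L ^ 2 * n ∧
      A.card ^ 2 ≤ 64 * L ^ 4 * (Λ'.card * t) ∧
      ∀ l ∈ Λ', ∃ c ∈ A, n ≤ ((slopeFiber A l).filter (fun a => c / a ∈ Λ)).card := by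
  set N := A.card with hN
  have hN0 : (0 : ℝ) < N := by exact_mod_cast hne.card_pos
  have hLR : (1 : ℝ) ≤ L := by exact_mod_cast hL
  have htR : (1 : ℝ) ≤ t := by exact_mod_cast ht
  let d : ℝ → ℕ := fun a => (Λ.filter (fun l => l * a ∈ A)).card
  let h : ℝ → ℕ := fun l => ∑ a ∈ slopeFiber A l, d a
  let e : ℝ → ℝ → ℕ := fun l c => ((slopeFiber A l).filter (fun a => c / a ∈ Λ)).card
  set g := ∑ l ∈ Λ, (slopeFiber A l).card with hgdef
  have hgR : (N : ℝ) ^ 2 ≤ 4 * L ^ 2 * g := by exact_mod_cast hg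
  have hg0 : (0 : ℝ) < g := by
    by_contra! hneg
    have : (N : ℝ) ^ 2 ≤ 0 := hgR.trans (mul_nonpos_of_nonneg_of_nonpos (by positivity) hneg)
    nlinarith
  have hsumd : ∑ a ∈ A, d a = g := by
    simp only [d, hgdef, slopeFiber, Finset.card_filter]
    exact Finset.sum_comm
  have hsumh : ∑ l ∈ Λ, h l = ∑ a ∈ A, d a ^ 2 := by
    simp only [h, slopeFiber, Finset.sum_filter]
    rw [Finset.sum_comm]
    refine Finset.sum_congr rfl fun a _ => ?_
    rw [← Finset.sum_filter, Finset.sum_const, smul_eq_mul, sq]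
  have hcs : (g : ℝ) ^ 2 ≤ N * ∑ l ∈ Λ, (h l : ℝ) := by
    have : g ^ 2 ≤ N * ∑ l ∈ Λ, h l := by
      rw [hsumh, ← hsumd]
      exact sq_sum_le_card_mul_sum_sq
    exact_mod_cast this
  have hd_eq : ∀ a ∈ A, d a = (A.filter (fun c => c / a ∈ Λ)).card := by
    intro a ha
    have ha0 := (hA a ha).ne'
    refine Finset.card_nbij' (fun l => l * a) (fun c => c / a) ?_ ?_ ?_ ?_
    · intro l hl
      simp only [Finset.coe_filter, Set.mem_ofPred_eq] at hl ⊢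
      rw [mul_div_cancel_right₀ _ ha0]
      exact ⟨hl.2, hl.1⟩
    · intro c hc
      simp only [Finset.coe_filter, Set.mem_ofPred_eq] at hc ⊢
      rw [div_mul_cancel₀ _ ha0]
      exact ⟨hc.2, hc.1⟩
    · intro l _
      exact mul_div_cancel_right₀ _ ha0
    · intro c _
      exact div_mul_cancel₀ _ ha0
  have hd_le : ∀ a ∈ A, d a ≤ N := by
    intro a ha
    rw [hd_eq a ha]
    exact Finset.card_filter_le _ _
  have hh_eq : ∀ l, h l = ∑ c ∈ A, e l c := by
    intro l
    simp only [h, e]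
    rw [Finset.sum_congr rfl fun a ha => hd_eq a (mem_slopeFiber.1 ha).1]
    simp only [Finset.card_filter]
    exact Finset.sum_comm
  have hh_le : ∀ l ∈ Λ, (h l : ℝ) ≤ 2 * t * N := by
    intro l hl
    have : h l ≤ 2 * t * N := by
      refine (Finset.sum_le_card_nsmul _ _ N fun a ha => hd_le a (mem_slopeFiber.1 ha).1).trans ?_
      rw [smul_eq_mul]
      exact Nat.mul_le_mul_right _ (hΛ l hl).2
    exact_mod_cast this
  have hΛt : (Λ.card : ℝ) * t ≤ g := by
    have : Λ.card * t ≤ g := by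
      rw [← smul_eq_mul]
      exact Finset.card_nsmul_le_sum _ _ _ fun l hl => (hΛ l hl).1
    exact_mod_cast this
  clear_value g
  obtain ⟨x, hx⟩ : ∃ x : ℝ, x = g * t / (2 * N ^ 2) := ⟨_, rfl⟩
  have hx0 : 0 < x := by
    rw [hx]
    exact div_pos (mul_pos hg0 (by linarith)) (mul_pos two_pos (pow_pos hN0 2))
  rw [eq_div_iff (by positivity)] at hx
  let good : ℝ → Prop := fun l => ∃ c ∈ A, ⌈x⌉₊ ≤ e l c
  classical
  refine ⟨Λ.filter good, ⌈x⌉₊, Finset.filter_subset _ _, Nat.ceil_pos.2 hx0, ?_, ?_, ?_⟩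
  · have h1 : x ≤ ⌈x⌉₊ := Nat.le_ceil x
    have h2 : (t : ℝ) ≤ 8 * L ^ 2 * x := by
      refine le_of_mul_le_mul_right ?_ (by positivity : (0 : ℝ) < N ^ 2)
      calc (t : ℝ) * N ^ 2 ≤ t * (4 * L ^ 2 * g) := mul_le_mul_of_nonneg_left hgR (by positivity)
        _ = 4 * L ^ 2 * (x * (2 * N ^ 2)) := by rw [hx]; ring
        _ = _ := by ring
    have h3 : (t : ℝ) ≤ 8 * L ^ 2 * ⌈x⌉₊ :=
      h2.trans (mul_le_mul_of_nonneg_left h1 (by positivity))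
    exact_mod_cast h3
  · have hbad : ∑ l ∈ Λ.filter (fun l => ¬ good l), (h l : ℝ) ≤ g * (g / (2 * N)) := by
      have h1 : ∀ l ∈ Λ.filter (fun l => ¬ good l), (h l : ℝ) ≤ N * x := by
        intro l hl
        have hl' := (Finset.mem_filter.1 hl).2
        simp only [good, not_exists, not_and, not_le] at hl'
        rw [hh_eq, Nat.cast_sum]
        refine (Finset.sum_le_card_nsmul _ _ x fun c hc => ?_).trans (by rw [nsmul_eq_mul])
        exact (Nat.lt_ceil.1 (hl' c hc)).le
      have h2 := Finset.sum_le_card_nsmul _ _ _ h1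
      rw [nsmul_eq_mul] at h2
      have h3 : ((Λ.filter (fun l => ¬ good l)).card : ℝ) ≤ Λ.card :=
        Nat.cast_le.2 (Finset.card_filter_le _ _)
      calc _ ≤ _ := h2
        _ ≤ (Λ.card : ℝ) * (N * x) := mul_le_mul_of_nonneg_right h3 (by positivity)
        _ = (Λ.card * t) * (g / (2 * N)) := by
          have : N * x = t * (g / (2 * N)) := by
            rw [mul_div_assoc', eq_div_iff (by positivity), mul_comm (t : ℝ), ← hx]; ring
          rw [this]; ring
        _ ≤ _ := mul_le_mul_of_nonneg_right hΛt (by positivity)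
    have hgood : ∑ l ∈ Λ.filter good, (h l : ℝ) ≤ (Λ.filter good).card * (2 * t * N) := by
      rw [← nsmul_eq_mul]
      exact Finset.sum_le_card_nsmul _ _ _ fun l hl => hh_le l (Finset.mem_filter.1 hl).1
    have hsplit := Finset.sum_filter_add_sum_filter_not Λ good (fun l => (h l : ℝ))
    have h1 : (g : ℝ) ^ 2 ≤ N * ((Λ.filter good).card * (2 * t * N)) + g ^ 2 / 2 := by
      have e1 : (N : ℝ) * (g * (g / (2 * N))) = g ^ 2 / 2 := by field_simp
      rw [← hsplit] at hcs
      nlinarith [mul_le_mul_of_nonneg_left (add_le_add hgood hbad) hN0.le]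
    have h2 : (g : ℝ) ^ 2 ≤ 4 * N ^ 2 * ((Λ.filter good).card * t) := by nlinarith
    have h3 : ((N : ℝ) ^ 2) ^ 2 ≤ (4 * L ^ 2 * g) ^ 2 := by gcongr
    have h4 : (N : ℝ) ^ 2 * N ^ 2 ≤ (64 * L ^ 4 * ((Λ.filter good).card * t)) * N ^ 2 := by
      have := mul_le_mul_of_nonneg_left h2 (by positivity : (0 : ℝ) ≤ 16 * L ^ 4)
      nlinarith
    have h5 := le_of_mul_le_mul_right h4 (by positivity)
    exact_mod_cast h5
  · intro l hl
    exact (Finset.mem_filter.1 hl).2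

/-- The configuration of slopes and points to which the cluster argument is applied. Each fibre
`F l` is a set of products in two ways: with one factor in `(A / A) ∩ l⁻¹ (A / A)` and the other
in `A`, and, up to a dilation, as quotients of `A / A`. The parameter `q` measures
`(A / A) ∩ l⁻¹ (A / A)`; the first bound is good when it is small, the second when it is large. -/
lemma exists_controlled_slopes (A : Finset ℝ) (hA : ∀ a ∈ A, 0 < a) (hne : A.Nonempty) (L : ℕ)
    (hL : L = Nat.log 2 A.card + 1) :
    ∃ (Λ : Finset ℝ) (F : ℝ → Finset ℝ) (n q : ℕ), 1 ≤ n ∧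
      A.card ^ 2 ≤ 512 * L ^ 6 * (Λ.card * n) ∧
      A.card ^ 2 ≤ 32 * L ^ 2 * ((A / A).card * n) ∧
      (∀ l ∈ Λ, (F l).card = n) ∧ (∀ l ∈ Λ, ∀ a ∈ F l, a ∈ A ∧ l * a ∈ A) ∧
      (∀ l₁ ∈ Λ, ∀ l₂ ∈ Λ, ∀ l₃ ∈ Λ, ∀ α β γ : ℝ, α ≠ 0 → β ≠ 0 → γ ≠ 0 → ∀ ρ : ℝ, 1 ≤ ρ →
        (A.card : ℝ) * (solutions α β γ (F l₁) (F l₂) (F l₃)).card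
          ≤ 6 * (q * n) * ρ + 4 * (A.card * n) ^ 2 / ρ ^ 2 ∧
        (q : ℝ) * (solutions α β γ (F l₁) (F l₂) (F l₃)).card
          ≤ 3 * ((A / A).card * n) * ρ + 4 * ((A / A).card * n) ^ 2 / ρ ^ 2) := by
  set Q := A / A with hQ
  have hQpos : ∀ x ∈ Q, 0 < x := fun x hx => pos_of_mem_div hA hx
  obtain ⟨Λ₀, t, q, ht, hr, hs, hNt, hg⟩ := exists_dyadic_class A hA hne
  rw [← hL] at hg
  obtain ⟨Λ, n, hΛsub, hn, htn, hNΛ, hc⟩ :=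
    exists_linked_slopes A Λ₀ hA hne t L ht (by omega) hr hg
  have hex : ∀ l, ∃ S : Finset ℝ, l ∈ Λ → S.card = n ∧ S ⊆ slopeFiber A l ∧
      ∃ c ∈ A, ∀ a ∈ S, c / a ∈ Λ₀ := by
    intro l
    by_cases hl : l ∈ Λ
    · obtain ⟨c, hcA, hcn⟩ := hc l hl
      obtain ⟨S, hS, hSn⟩ := Finset.exists_subset_card_eq hcn
      exact ⟨S, fun _ => ⟨hSn, hS.trans (Finset.filter_subset _ _), c, hcA,
        fun a ha => (Finset.mem_filter.1 (hS ha)).2⟩⟩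
    · exact ⟨∅, fun h => absurd h hl⟩
  choose F hF using hex
  refine ⟨Λ, F, n, q, hn, ?_, ?_, fun l hl => (hF l hl).1,
    fun l hl a ha => mem_slopeFiber.1 ((hF l hl).2.1 ha), ?_⟩
  · calc _ ≤ _ := hNΛ
      _ ≤ 64 * L ^ 4 * (Λ.card * (8 * L ^ 2 * n)) := by gcongr
      _ = _ := by ring
  · calc _ ≤ _ := hNt
      _ ≤ 4 * Q.card * (8 * L ^ 2 * n) := by gcongr
      _ = _ := by ring
  · intro l₁ h₁ l₂ h₂ l₃ h₃ α β γ hα hβ hγ ρ hρ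
    obtain ⟨-, hsub, c, hcA, hcΛ⟩ := hF l₁ h₁
    constructor
    · have := mul_card_solutions_le (F l₁) (F l₂) (F l₃) (slopeFiber Q l₁) A A.card
        (fun u hu => hQpos u (mem_slopeFiber.1 hu).1) ?_ α β γ hα hβ hγ ρ hρ
      · rw [(hF l₂ h₂).1, (hF l₃ h₃).1] at this
        refine this.trans (add_le_add_left ?_ _)
        have h2 : ((slopeFiber Q l₁).card : ℝ) ≤ 2 * q := by
          exact_mod_cast (hs l₁ (hΛsub h₁)).2
        calc 3 * (((slopeFiber Q l₁).card : ℝ) * n) * ρ ≤ 3 * (2 * q * n) * ρ := by gcongr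
          _ = _ := by ring
      · intro a ha
        have ha' := hsub ha
        refine Finset.card_le_card_of_injOn (fun b => (a / b, b)) (fun b hb => ?_) ?_
        · simp only [Finset.coe_filter, Finset.mem_product, Set.mem_ofPred_eq]
          exact ⟨⟨div_mem_slopeFiber_div ha' hb, hb⟩, div_mul_cancel₀ _ (hA b hb).ne'⟩
        · intro b _ b' _ h
          exact (Prod.mk.inj h).2
    · have hc0 := hA c hcA
      have := mul_card_solutions_le (F l₁) (F l₂) (F l₃) (Q.image (c * ·)) (Q.image (·⁻¹)) q
        ?_ ?_ α β γ hα hβ hγ ρ hρ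
      · rwa [(hF l₂ h₂).1, (hF l₃ h₃).1,
          Finset.card_image_of_injective _ (mul_right_injective₀ hc0.ne'),
          Finset.card_image_of_injective _ inv_injective] at this
      · intro x hx
        obtain ⟨u, hu, rfl⟩ := Finset.mem_image.1 hx
        exact mul_pos hc0 (hQpos u hu)
      · intro a ha
        have ha0 := (hA a (mem_slopeFiber.1 (hsub ha)).1).ne'
        refine (hs _ (hcΛ a ha)).1.trans ?_
        -- `a = c / μ` with `μ = c / a`, and every `u` with `u, μ u ∈ A / A` gives `a = c u / (μ u)`
        refine Finset.card_le_card_of_injOn (fun u => (c * u, (c / a * u)⁻¹)) (fun u hu => ?_) ?_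
        · obtain ⟨h1, h2⟩ := mem_slopeFiber.1 (Finset.mem_coe.1 hu)
          have hu0 := (hQpos u h1).ne'
          simp only [Finset.coe_filter, Finset.mem_product, Set.mem_ofPred_eq]
          refine ⟨⟨Finset.mem_image_of_mem _ h1, Finset.mem_image_of_mem _ h2⟩, ?_⟩
          field_simp
        · intro u _ u' _ h
          exact mul_left_cancel₀ hc0.ne' (Prod.mk.inj h).1

/-! ### Optimisation for sets of positive numbers -/

/-- The optimisation in the parameters `|A| = ν ^ 6`, `|A / A| = k ^ 15 |A|` and `n = w ^ 3`, which
make all exponents integers. -/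
lemma pow_le_card_add_sq (A : Finset ℝ) (hA : ∀ a ∈ A, 0 < a) (hne : A.Nonempty) (L : ℕ)
    (hL : L = Nat.log 2 A.card + 1) (ν k : ℝ) (hν : 1 ≤ ν) (hk : 1 ≤ k)
    (hN : ν ^ 6 = A.card) (hQ : k ^ 15 * ν ^ 6 = (A / A).card) :
    ν ^ 19 ≤ 2 ^ 24 * (L : ℝ) ^ 12 * k ^ 24 * ((A + A).card : ℝ) ^ 2 := by
  obtain ⟨Λ, F, n, q, hn, h512, h32, hFn, hFA, hsol⟩ := exists_controlled_slopes A hA hne L hL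
  have hℓ : (1 : ℝ) ≤ L := by
    rw [hL]
    exact_mod_cast Nat.le_add_left 1 _
  have h512R : (A.card : ℝ) ^ 2 ≤ 512 * (L : ℝ) ^ 6 * (Λ.card * n) := by exact_mod_cast h512
  have h32R : (A.card : ℝ) ^ 2 ≤ 32 * (L : ℝ) ^ 2 * ((A / A).card * n) := by exact_mod_cast h32
  have hnR : (1 : ℝ) ≤ n := by exact_mod_cast hn
  have hQA : ((A / A).card : ℝ) ≤ A.card * A.card := by exact_mod_cast Finset.card_div_le
  obtain ⟨w, hw1, hwn⟩ : ∃ w : ℝ, 1 ≤ w ∧ w ^ 3 = n := by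
    refine ⟨(n : ℝ) ^ ((1 : ℝ) / 3), Real.one_le_rpow hnR (by norm_num), ?_⟩
    rw [← Real.rpow_natCast, ← Real.rpow_mul (by linarith)]
    norm_num
  rw [← hN] at h512R h32R hQA
  rw [← hQ] at h32R hQA
  rw [← hN, ← hQ] at hsol
  rw [← hwn] at h512R h32R hsol
  set ℓ : ℝ := (L : ℝ) with hℓdef
  set σ : ℝ := ((A + A).card : ℝ) with hσ
  clear_value ℓ
  have hν0 : 0 < ν := by linarith
  have hk0 : 0 < k := by linarith
  have hw0 : 0 < w := by linarith
  have hkν : k ^ 15 ≤ ν ^ 6 := by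
    refine le_of_mul_le_mul_right hQA (by positivity)
  have hkν' : k ^ 4 ≤ ν ^ 2 := by
    refine le_of_pow_le_pow_left₀ (n := 3) (by norm_num) (by positivity) ?_
    calc (k ^ 4) ^ 3 = k ^ 12 := by ring
      _ ≤ k ^ 15 := pow_le_pow_right₀ hk (by norm_num)
      _ ≤ ν ^ 6 := hkν
      _ = _ := by ring
  have hT : ∀ l₁ ∈ Λ, ∀ l₂ ∈ Λ, ∀ l₃ ∈ Λ, ∀ α β γ : ℝ, α ≠ 0 → β ≠ 0 → γ ≠ 0 →
      ((solutions α β γ (F l₁) (F l₂) (F l₃)).card : ℝ) ≤ 10 * k ^ 8 * ν ^ 2 * w ^ 4 := by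
    intro l₁ h₁ l₂ h₂ l₃ h₃ α β γ hα hβ hγ
    have hs := hsol l₁ h₁ l₂ h₂ l₃ h₃ α β γ hα hβ hγ
    set s : ℝ := ((solutions α β γ (F l₁) (F l₂) (F l₃)).card : ℝ) with hsdef
    have hs0 : 0 ≤ s := Nat.cast_nonneg _
    clear_value s
    -- `ν ^ 6 * k ^ 12` is `|A| K ^ (4 / 5)`; in each case `ρ` balances the two incidence terms
    rcases le_total (q : ℝ) (ν ^ 6 * k ^ 12) with hq' | hq'
    · have h := (hs (ν ^ 2 * w / k ^ 4) (by
        rw [le_div_iff₀ (by positivity), one_mul]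
        nlinarith [mul_le_mul_of_nonneg_left hw1 (by positivity : 0 ≤ ν ^ 2)])).1
      have h1 : 6 * (q * w ^ 3) * (ν ^ 2 * w / k ^ 4)
          ≤ 6 * (ν ^ 6 * k ^ 12 * w ^ 3) * (ν ^ 2 * w / k ^ 4) := by gcongr
      have e1 : 6 * (ν ^ 6 * k ^ 12 * w ^ 3) * (ν ^ 2 * w / k ^ 4)
          = ν ^ 6 * (6 * k ^ 8 * ν ^ 2 * w ^ 4) := by field_simp
      have e2 : 4 * (ν ^ 6 * w ^ 3) ^ 2 / (ν ^ 2 * w / k ^ 4) ^ 2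
          = ν ^ 6 * (4 * k ^ 8 * ν ^ 2 * w ^ 4) := by field_simp
      rw [e2] at h
      rw [e1] at h1
      refine le_of_mul_le_mul_left ?_ (by positivity : 0 < ν ^ 6)
      linarith
    · have h := (hs (k ^ 5 * ν ^ 2 * w) (by
        exact one_le_mul_of_one_le_of_one_le
          (one_le_mul_of_one_le_of_one_le (one_le_pow₀ hk) (one_le_pow₀ hν)) hw1)).2
      have e2 : 4 * (k ^ 15 * ν ^ 6 * w ^ 3) ^ 2 / (k ^ 5 * ν ^ 2 * w) ^ 2
          = (ν ^ 6 * k ^ 12) * (4 * k ^ 8 * ν ^ 2 * w ^ 4) := by field_simp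
      rw [e2] at h
      refine le_of_mul_le_mul_left ?_ (by positivity : 0 < ν ^ 6 * k ^ 12)
      have h1 := mul_le_mul_of_nonneg_right hq' hs0
      have h2 : 0 ≤ ν ^ 6 * k ^ 12 * (k ^ 8 * ν ^ 2 * w ^ 4) := by positivity
      nlinarith
  have hcl := fun M => mul_card_mul_sq_le A Λ F n M (10 * k ^ 8 * ν ^ 2 * w ^ 4) hFn
    (fun l hl a ha => hA a (hFA l hl a ha).1) hFA hT
  rw [← hwn, ← hσ] at hcl
  clear_value σ
  have hνw : ν ^ 2 ≤ 4 * ℓ * k ^ 5 * w := by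
    refine le_of_pow_le_pow_left₀ (n := 3) (by norm_num) (by positivity) ?_
    have h1 : ν ^ 6 ≤ 32 * ℓ ^ 2 * (k ^ 15 * w ^ 3) := by
      refine le_of_mul_le_mul_right ?_ (by positivity : 0 < ν ^ 6)
      linarith
    have h2 : ℓ ^ 2 ≤ ℓ ^ 3 := pow_le_pow_right₀ hℓ (by norm_num)
    have h3 : ℓ ^ 2 * (k ^ 15 * w ^ 3) ≤ ℓ ^ 3 * (k ^ 15 * w ^ 3) :=
      mul_le_mul_of_nonneg_right h2 (by positivity)
    have h4 : 0 ≤ ℓ ^ 3 * (k ^ 15 * w ^ 3) := by positivity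
    calc (ν ^ 2) ^ 3 = ν ^ 6 := by ring
      _ ≤ 64 * (ℓ ^ 3 * (k ^ 15 * w ^ 3)) := by linarith
      _ = _ := by ring
  have hνw4 : ν ^ 8 ≤ 256 * ℓ ^ 4 * k ^ 20 * w ^ 4 := by
    calc ν ^ 8 = (ν ^ 2) ^ 4 := by ring
      _ ≤ (4 * ℓ * k ^ 5 * w) ^ 4 := by gcongr
      _ = _ := by ring
  have hΛn : ν ^ 12 ≤ 512 * ℓ ^ 6 * (Λ.card * w ^ 3) := by
    calc ν ^ 12 = (ν ^ 6) ^ 2 := by ring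
      _ ≤ _ := h512R
  have h1924 : ν ^ 19 ≤ ν ^ 24 := pow_le_pow_right₀ hν (by norm_num)
  have hk24 : 1 ≤ k ^ 24 := one_le_pow₀ hk
  have hfit : ∀ x : ℝ, 0 ≤ x → x ≤ w / (4 * k ^ 4 * ν) →
      x ^ 2 * (10 * k ^ 8 * ν ^ 2 * w ^ 4) ≤ (w ^ 3) ^ 2 := by
    intro x hx0 hx
    calc x ^ 2 * (10 * k ^ 8 * ν ^ 2 * w ^ 4)
        ≤ (w / (4 * k ^ 4 * ν)) ^ 2 * (10 * k ^ 8 * ν ^ 2 * w ^ 4) := by gcongr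
      _ = 10 / 16 * (w ^ 3) ^ 2 := by field_simp; norm_num
      _ ≤ (w ^ 3) ^ 2 := by linarith [sq_nonneg (w ^ 3)]
  -- any cluster size `M` that is at least half of `w / (4 k ^ 4 ν)` is good enough
  have main : ∀ M : ℕ, 2 ≤ M → M ≤ Λ.card → (M = 2 ∨ (M : ℝ) ≤ w / (4 * k ^ 4 * ν)) →
      w / (8 * k ^ 4 * ν) ≤ M →
      ν ^ 19 ≤ 2 ^ 24 * ℓ ^ 12 * k ^ 24 * σ ^ 2 := by
    intro M hM hMΛ hMr hMlow
    have h := hcl M hM hMΛ (hMr.imp id (hfit M (Nat.cast_nonneg M)))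
    rw [div_le_iff₀ (by positivity)] at hMlow
    have h1 : w ^ 4 * (Λ.card * w ^ 3) ≤ 16 * σ ^ 2 * (8 * k ^ 4 * ν) := by
      calc w ^ 4 * (Λ.card * w ^ 3) = w * (Λ.card * (w ^ 3) ^ 2) := by ring
        _ ≤ M * (8 * k ^ 4 * ν) * (Λ.card * (w ^ 3) ^ 2) := by gcongr
        _ = (M * Λ.card * (w ^ 3) ^ 2) * (8 * k ^ 4 * ν) := by ring
        _ ≤ _ := mul_le_mul_of_nonneg_right h (by positivity)
    refine le_of_mul_le_mul_right ?_ hν0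
    calc ν ^ 19 * ν = ν ^ 8 * ν ^ 12 := by ring
      _ ≤ (256 * ℓ ^ 4 * k ^ 20 * w ^ 4) * (512 * ℓ ^ 6 * (Λ.card * w ^ 3)) := by gcongr
      _ = 2 ^ 17 * ℓ ^ 10 * k ^ 20 * (w ^ 4 * (Λ.card * w ^ 3)) := by ring
      _ ≤ 2 ^ 17 * ℓ ^ 12 * k ^ 20 * (16 * σ ^ 2 * (8 * k ^ 4 * ν)) := by
        gcongr
        norm_num
      _ = _ := by ring
  rcases Nat.lt_or_ge Λ.card 2 with hΛ2 | hΛ2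
  · -- with a single slope, `|A|` is at most a power of the logarithm
    have hν6 : ν ^ 6 ≤ 512 * ℓ ^ 6 := by
      rcases Λ.eq_empty_or_nonempty with h0 | ⟨l, hl⟩
      · rw [h0] at hΛn
        simp only [Finset.card_empty, Nat.cast_zero, zero_mul, mul_zero] at hΛn
        exact absurd hΛn (pow_pos hν0 12).not_ge
      · have h1 : (Λ.card : ℝ) ≤ 1 := by exact_mod_cast Nat.lt_succ_iff.1 hΛ2
        have h2 : w ^ 3 ≤ ν ^ 6 := by
          rw [hwn, hN, ← hFn l hl]
          exact Nat.cast_le.2 (Finset.card_le_card fun a ha => (hFA l hl a ha).1)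
        refine le_of_mul_le_mul_right ?_ (by positivity : 0 < ν ^ 6)
        calc ν ^ 6 * ν ^ 6 = ν ^ 12 := by ring
          _ ≤ _ := hΛn
          _ ≤ 512 * ℓ ^ 6 * (1 * ν ^ 6) := by gcongr
          _ = _ := by ring
    have hσν : ν ^ 6 ≤ σ := by
      rw [hN, hσ]
      exact Nat.cast_le.2 (Finset.card_le_card_add_right hne)
    calc ν ^ 19 ≤ ν ^ 24 := h1924
      _ = (ν ^ 6) ^ 2 * (ν ^ 6) ^ 2 := by ring
      _ ≤ (512 * ℓ ^ 6) ^ 2 * σ ^ 2 := by gcongr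
      _ = 2 ^ 18 * ℓ ^ 12 * 1 * σ ^ 2 := by ring
      _ ≤ 2 ^ 24 * ℓ ^ 12 * k ^ 24 * σ ^ 2 := by gcongr <;> norm_num
  have hdouble : w / (4 * k ^ 4 * ν) = 2 * (w / (8 * k ^ 4 * ν)) := by field_simp; norm_num
  rcases lt_or_ge (w / (4 * k ^ 4 * ν)) 2 with hMr | hMr
  · refine main 2 le_rfl hΛ2 (Or.inl rfl) ?_
    push_cast
    linarith
  have hfl : 2 ≤ ⌊w / (4 * k ^ 4 * ν)⌋₊ := Nat.le_floor (by exact_mod_cast hMr)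
  have hfl2 : (⌊w / (4 * k ^ 4 * ν)⌋₊ : ℝ) ≤ w / (4 * k ^ 4 * ν) := Nat.floor_le (by positivity)
  rcases le_total ⌊w / (4 * k ^ 4 * ν)⌋₊ Λ.card with hM | hM
  · refine main _ hfl hM (Or.inr hfl2) ?_
    have := Nat.lt_floor_add_one (w / (4 * k ^ 4 * ν))
    linarith
  · -- all the slopes fit into one cluster
    have hΛr : (Λ.card : ℝ) ≤ w / (4 * k ^ 4 * ν) := (Nat.cast_le.2 hM).trans hfl2
    have h := hcl Λ.card hΛ2 le_rfl (Or.inr (hfit _ (Nat.cast_nonneg _) hΛr))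
    calc ν ^ 19 ≤ ν ^ 24 := h1924
      _ = (ν ^ 12) ^ 2 := by ring
      _ ≤ (512 * ℓ ^ 6 * (Λ.card * w ^ 3)) ^ 2 := by gcongr
      _ = 2 ^ 18 * ℓ ^ 12 * (Λ.card * Λ.card * (w ^ 3) ^ 2) := by ring
      _ ≤ 2 ^ 18 * ℓ ^ 12 * (16 * σ ^ 2) := by gcongr
      _ = 2 ^ 22 * ℓ ^ 12 * 1 * σ ^ 2 := by ring
      _ ≤ 2 ^ 24 * ℓ ^ 12 * k ^ 24 * σ ^ 2 := by gcongr <;> norm_num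

lemma rpow_mul_rpow_le_of_pos (A : Finset ℝ) (hA : ∀ a ∈ A, 0 < a) (hne : A.Nonempty) (K : ℝ)
    (hK : ((A / A).card : ℝ) ≤ K * A.card) :
    (A.card : ℝ) ^ (19 / 12 : ℝ) * K ^ (-(4 / 5) : ℝ)
      ≤ 2 ^ 12 * ((Nat.log 2 A.card + 1 : ℕ) : ℝ) ^ 6 * (A + A).card := by
  have hN : (1 : ℝ) ≤ A.card := by exact_mod_cast hne.card_pos
  have hN0 : (0 : ℝ) < A.card := by linarith
  set κ : ℝ := (A / A).card / A.card with hκ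
  have hκK : κ ≤ K := by rwa [hκ, div_le_iff₀ hN0]
  have hκ1 : 1 ≤ κ := by
    rw [hκ, le_div_iff₀ hN0, one_mul]
    obtain ⟨a, ha⟩ := hne
    refine Nat.cast_le.2 (Finset.card_le_card_of_injOn (· / a) (fun b hb => ?_) ?_)
    · exact Finset.mem_coe.2 (Finset.div_mem_div hb ha)
    · intro b _ c _ h
      exact (div_left_inj' (hA a ha).ne').1 h
  have hκ0 : 0 < κ := by linarith
  have hκN : κ * A.card = (A / A).card := div_mul_cancel₀ _ hN0.ne'
  clear_value κ
  have h := pow_le_card_add_sq A hA hne _ rfl ((A.card : ℝ) ^ ((1 : ℝ) / 6)) (κ ^ ((1 : ℝ) / 15))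
    (Real.one_le_rpow hN (by norm_num)) (Real.one_le_rpow hκ1 (by norm_num))
    (by rw [← Real.rpow_natCast, ← Real.rpow_mul hN0.le]; norm_num)
    (by rw [← Real.rpow_natCast, ← Real.rpow_natCast, ← Real.rpow_mul hN0.le,
          ← Real.rpow_mul hκ0.le]; norm_num; exact hκN)
  rw [← Real.rpow_natCast _ 19, ← Real.rpow_natCast (κ ^ _) 24, ← Real.rpow_mul hN0.le,
    ← Real.rpow_mul hκ0.le] at h
  have hmono : K ^ (-(4 / 5) : ℝ) ≤ κ ^ (-(4 / 5) : ℝ) :=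
    Real.rpow_le_rpow_of_nonpos hκ0 hκK (by norm_num)
  refine (mul_le_mul_of_nonneg_left hmono (by positivity)).trans ?_
  refine le_of_sq_le_sq ?_ (by positivity)
  have e1 : ((A.card : ℝ) ^ (19 / 12 : ℝ) * κ ^ (-(4 / 5) : ℝ)) ^ 2
      = (A.card : ℝ) ^ (1 / 6 * ((19 : ℕ) : ℝ)) * (κ ^ (1 / 15 * ((24 : ℕ) : ℝ)))⁻¹ := by
    rw [mul_pow, ← Real.rpow_natCast, ← Real.rpow_natCast, ← Real.rpow_mul hN0.le,
      ← Real.rpow_mul hκ0.le, ← Real.rpow_neg hκ0.le]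
    norm_num
  rw [e1, ← div_eq_mul_inv, div_le_iff₀ (by positivity)]
  refine h.trans (le_of_eq ?_)
  ring

/-! ### General sets and comparison of exponents -/

/-- Up to a sign, a positive proportion of `A` is positive. -/
lemma exists_pos_subset (A : Finset ℝ) (hA : 2 ≤ A.card) :
    ∃ B : Finset ℝ, (∀ b ∈ B, 0 < b) ∧ B.Nonempty ∧ A.card ≤ 4 * B.card ∧ B.card ≤ A.card ∧
      (B + B).card ≤ (A + A).card ∧ (B / B).card ≤ (A / A).card := by
  have hsplit : A.card ≤ (A.filter (0 < ·)).card + (A.filter (· < 0)).card + 1 := by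
    calc A.card ≤ ((A.filter (0 < ·) ∪ A.filter (· < 0)) ∪ {0}).card := by
          refine Finset.card_le_card fun a ha => ?_
          rcases lt_trichotomy a 0 with h | h | h <;> simp [ha, h]
      _ ≤ _ := by
          refine (Finset.card_union_le _ _).trans ?_
          rw [Finset.card_singleton]
          exact Nat.add_le_add_right (Finset.card_union_le _ _) 1
  rcases le_total (A.filter (· < 0)).card (A.filter (0 < ·)).card with h | h
  · refine ⟨A.filter (0 < ·), fun b hb => (Finset.mem_filter.1 hb).2,
      Finset.card_pos.1 (by omega), by omega, Finset.card_filter_le _ _,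
      Finset.card_le_card (Finset.add_subset_add (Finset.filter_subset _ _)
        (Finset.filter_subset _ _)),
      Finset.card_le_card (Finset.div_subset_div (Finset.filter_subset _ _)
        (Finset.filter_subset _ _))⟩
  · have hc : (-(A.filter (· < 0))).card = (A.filter (· < 0)).card := Finset.card_neg _
    have hmem : ∀ b ∈ -(A.filter (· < 0)), -b ∈ A ∧ 0 < b := by
      intro b hb
      have := Finset.mem_filter.1 (Finset.mem_neg'.1 hb)
      exact ⟨this.1, by linarith [this.2]⟩
    refine ⟨-(A.filter (· < 0)), fun b hb => (hmem b hb).2,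
      Finset.card_pos.1 (by omega), by omega, by rw [hc]; exact Finset.card_filter_le _ _,
      Finset.card_le_card_of_injOn (fun x => -x) (fun x hx => ?_)
        (fun x _ y _ h => neg_injective h), Finset.card_le_card fun x hx => ?_⟩
    · obtain ⟨a, ha, b, hb, rfl⟩ := Finset.mem_add.1 (Finset.mem_coe.1 hx)
      simp only [neg_add]
      exact Finset.mem_coe.2 (Finset.add_mem_add (hmem a ha).1 (hmem b hb).1)
    · obtain ⟨a, ha, b, hb, rfl⟩ := Finset.mem_div.1 hx
      rw [← neg_div_neg_eq a b]
      exact Finset.div_mem_div (hmem a ha).1 (hmem b hb).1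

lemma natLog_add_one_le (N : ℕ) (hN : 2 ≤ N) :
    ((Nat.log 2 N + 1 : ℕ) : ℝ) ≤ 3 * Real.log N := by
  have h1 : 1 ≤ Nat.log 2 N := Nat.log_pos (by norm_num) hN
  have h2 : ((2 ^ Nat.log 2 N : ℕ) : ℝ) ≤ N := Nat.cast_le.2 (Nat.pow_log_le_self 2 (by omega))
  have h3 := Real.log_le_log (by positivity) h2
  push_cast at h3 ⊢
  rw [Real.log_pow] at h3
  have h4 : (1 : ℝ) ≤ Nat.log 2 N := by exact_mod_cast h1
  nlinarith [Real.log_two_gt_d9]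

/-- The sum-set bound for sets with few quotients, stronger than both bounds of the theorem. -/
lemma rpow_mul_rpow_le_card_add (A : Finset ℝ) (hA : 2 ≤ A.card) (K : ℝ) (hK1 : 1 ≤ K)
    (hK : ((A / A).card : ℝ) ≤ K * A.card) :
    (A.card : ℝ) ^ (19 / 12 : ℝ) * K ^ (-(4 / 5) : ℝ)
      ≤ 2 ^ 18 * 3 ^ 6 * (A + A).card * Real.log A.card ^ 6 := by
  obtain ⟨B, hB, hne, h4, hBA, hadd, hdiv⟩ := exists_pos_subset A hA
  have h4R : (A.card : ℝ) ≤ 4 * B.card := by exact_mod_cast h4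
  have hB1 : (1 : ℝ) ≤ B.card := by exact_mod_cast hne.card_pos
  have hdivR : ((B / B).card : ℝ) ≤ (A / A).card := by exact_mod_cast hdiv
  have haddR : ((B + B).card : ℝ) ≤ (A + A).card := by exact_mod_cast hadd
  have hK0 : 0 < K := by linarith
  have key := rpow_mul_rpow_le_of_pos B hB hne (4 * K) (by nlinarith)
  have hlog : ((Nat.log 2 B.card + 1 : ℕ) : ℝ) ≤ 3 * Real.log A.card :=
    le_trans (Nat.cast_le.2 (Nat.add_le_add_right (Nat.log_mono_right hBA) 1))
      (natLog_add_one_le _ hA)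
  have e1 : (A.card : ℝ) ^ (19 / 12 : ℝ) ≤ 4 ^ (19 / 12 : ℝ) * (B.card : ℝ) ^ (19 / 12 : ℝ) := by
    rw [← Real.mul_rpow (by norm_num) (by positivity)]
    exact Real.rpow_le_rpow (by positivity) h4R (by norm_num)
  have e2 : K ^ (-(4 / 5) : ℝ) = 4 ^ (4 / 5 : ℝ) * (4 * K) ^ (-(4 / 5) : ℝ) := by
    rw [Real.mul_rpow (by norm_num) hK0.le, ← mul_assoc, ← Real.rpow_add (by norm_num)]
    norm_num
  have e3 : (4 : ℝ) ^ (19 / 12 : ℝ) * 4 ^ (4 / 5 : ℝ) ≤ 2 ^ 6 := by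
    rw [← Real.rpow_add (by norm_num)]
    calc (4 : ℝ) ^ (19 / 12 + 4 / 5 : ℝ) ≤ 4 ^ ((3 : ℕ) : ℝ) :=
          Real.rpow_le_rpow_of_exponent_le (by norm_num) (by norm_num)
      _ = 2 ^ 6 := by rw [Real.rpow_natCast]; norm_num
  calc (A.card : ℝ) ^ (19 / 12 : ℝ) * K ^ (-(4 / 5) : ℝ)
      ≤ (4 ^ (19 / 12 : ℝ) * (B.card : ℝ) ^ (19 / 12 : ℝ)) *
        (4 ^ (4 / 5 : ℝ) * (4 * K) ^ (-(4 / 5) : ℝ)) := by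
        rw [← e2]; gcongr
    _ = (4 ^ (19 / 12 : ℝ) * 4 ^ (4 / 5 : ℝ)) *
        ((B.card : ℝ) ^ (19 / 12 : ℝ) * (4 * K) ^ (-(4 / 5) : ℝ)) := by ring
    _ ≤ 2 ^ 6 * (2 ^ 12 * (3 * Real.log A.card) ^ 6 * (A + A).card) := by
        refine mul_le_mul e3 (key.trans ?_) (by positivity) (by positivity)
        gcongr
    _ = _ := by ring

theorem theorem5 :
    -- the lower bound for the sumset, up to a constant and a power of the logarithm
    (∃ C : ℝ, 0 < C ∧ ∃ c : ℝ, 0 < c ∧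
      ∀ A : Finset ℝ, 2 ≤ A.card → ∀ K : ℝ, 1 ≤ K →
        ((A / A).card : ℝ) ≤ K * (A.card : ℝ) →
        max ((A.card : ℝ) ^ (19 / 12 : ℝ) * K ^ (-(5 / 6) : ℝ))
            ((A.card : ℝ) ^ (1313 / 830 : ℝ) * K ^ (-(336 / 415) : ℝ))
          ≤ C * ((A + A).card : ℝ) * Real.log (A.card : ℝ) ^ c) ∧
    -- the new bound is strictly larger than both earlier ones in the range without logarithms
    (∀ N : ℝ, 2 ≤ N → ∀ K : ℝ, N ^ (5 / 23 : ℝ) ≤ K → K < N ^ (673 / 2867 : ℝ) →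
      max (N ^ (19 / 12 : ℝ) * K ^ (-(5 / 6) : ℝ)) (N ^ (49 / 32 : ℝ) * K ^ (-(19 / 32) : ℝ))
        < max (N ^ (19 / 12 : ℝ) * K ^ (-(5 / 6) : ℝ))
            (N ^ (1313 / 830 : ℝ) * K ^ (-(336 / 415) : ℝ))) ∧
    -- and it dominates them up to logarithms when the range is relaxed by logarithms
    (∀ C₁ : ℝ, 0 < C₁ → ∀ c₁ : ℝ, 0 < c₁ → ∃ C : ℝ, 0 < C ∧ ∃ c : ℝ, 0 < c ∧
      ∀ N : ℝ, 2 ≤ N → ∀ K : ℝ, 1 ≤ K →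
        N ^ (5 / 23 : ℝ) ≤ C₁ * K * Real.log N ^ c₁ →
        K ≤ C₁ * N ^ (673 / 2867 : ℝ) * Real.log N ^ c₁ →
        max (N ^ (19 / 12 : ℝ) * K ^ (-(5 / 6) : ℝ)) (N ^ (49 / 32 : ℝ) * K ^ (-(19 / 32) : ℝ))
          ≤ C * (N ^ (1313 / 830 : ℝ) * K ^ (-(336 / 415) : ℝ)) * Real.log N ^ c) := by
  have hexp : ∀ N K a b : ℝ, 0 < N → 0 < K →
      N ^ a * K ^ b = Real.exp (Real.log N * a + Real.log K * b) := by
    intro N K a b hN hK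
    rw [Real.rpow_def_of_pos hN, Real.rpow_def_of_pos hK, Real.exp_add]
  refine ⟨⟨2 ^ 18 * 3 ^ 6, by norm_num, 6, by norm_num, ?_⟩, ?_, ?_⟩
  · intro A hA K hK1 hK
    have hN : (1 : ℝ) ≤ A.card := by exact_mod_cast (by omega : 1 ≤ A.card)
    have key := rpow_mul_rpow_le_card_add A hA K hK1 hK
    have e6 : Real.log (A.card : ℝ) ^ (6 : ℝ) = Real.log (A.card : ℝ) ^ 6 := by
      exact_mod_cast Real.rpow_natCast (Real.log A.card) 6
    rw [e6]
    refine max_le (le_trans ?_ key) (le_trans ?_ key)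
    · exact mul_le_mul_of_nonneg_left (Real.rpow_le_rpow_of_exponent_le hK1 (by norm_num))
        (by positivity)
    · exact mul_le_mul (Real.rpow_le_rpow_of_exponent_le hN (by norm_num))
        (Real.rpow_le_rpow_of_exponent_le hK1 (by norm_num)) (by positivity) (by positivity)
  · intro N hN K h1 h2
    have hN0 : 0 < N := by linarith
    have hK0 : 0 < K := (Real.rpow_pos_of_pos hN0 _).trans_le h1
    have hx : 0 < Real.log N := Real.log_pos (by linarith)
    have h1' := Real.log_le_log (Real.rpow_pos_of_pos hN0 _) h1
    have h2' := Real.log_lt_log hK0 h2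
    rw [Real.log_rpow hN0] at h1' h2'
    rw [hexp N K _ _ hN0 hK0, hexp N K _ _ hN0 hK0, hexp N K _ _ hN0 hK0]
    refine max_lt (lt_max_of_lt_right ?_) (lt_max_of_lt_right ?_) <;>
      · rw [Real.exp_lt_exp]
        linarith
  · intro C₁ hC₁ c₁ hc₁
    -- `log N` may be below `1`, but `log log N` is bounded below by `log log 2`
    refine ⟨Real.exp (|Real.log C₁| + |c₁ * Real.log (Real.log 2)|), Real.exp_pos _, c₁, hc₁, ?_⟩
    intro N hN K hK h1 h2
    have hN0 : 0 < N := by linarith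
    have hK0 : 0 < K := by linarith
    have hx : 0 < Real.log N := Real.log_pos (by linarith)
    have hl2 : 0 < Real.log 2 := Real.log_pos (by norm_num)
    have hz : c₁ * Real.log (Real.log 2) ≤ c₁ * Real.log (Real.log N) :=
      mul_le_mul_of_nonneg_left
        (Real.log_le_log hl2 (Real.log_le_log (by norm_num) hN)) hc₁.le
    have h1' := Real.log_le_log (Real.rpow_pos_of_pos hN0 _) h1
    have h2' := Real.log_le_log hK0 h2
    rw [Real.log_mul (by positivity) (by positivity), Real.log_mul (by positivity) (by positivity),
      Real.log_rpow hN0, Real.log_rpow hx] at h1'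
    rw [Real.log_mul (by positivity) (by positivity), Real.log_mul (by positivity) (by positivity),
      Real.log_rpow hN0, Real.log_rpow hx] at h2'
    rw [hexp N K _ _ hN0 hK0, hexp N K _ _ hN0 hK0, hexp N K _ _ hN0 hK0,
      Real.rpow_def_of_pos hx, ← Real.exp_add, ← Real.exp_add, mul_comm (Real.log (Real.log N))]
    have a1 := le_abs_self (Real.log C₁)
    have a2 := neg_abs_le (c₁ * Real.log (Real.log 2))
    have a3 := abs_nonneg (Real.log C₁)
    have a4 := abs_nonneg (c₁ * Real.log (Real.log 2))
    refine max_le ?_ ?_ <;>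
      · rw [Real.exp_le_exp]
        linarith
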